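/- **Conventions.** A (simple) chirotope on a finite set $V$ is a map $\chi$ from the ordered triples of distinct elements of $V$ to $\{\pm1\}$ that satisfies the following, for distinct elements. Symmetry: $\chi$ is alternating. Interiority: $\chi(t,y,z)=\chi(x,t,z)=\chi(x,y,t)=1$ implies $\chi(x,y,z)=1$. Transitivity: $\chi(t,s,x)=\chi(t,s,y)=\chi(t,s,z)=\chi(x,y,t)=\chi(y,z,t)=1$ implies $\chi(x,z,t)=1$. A rooted chirotope $(\chi,u)$ is a chirotope on a set $X\cup\{u\}$, $u\notin X\neq\emptyset$, whose root $u$ is extreme; $u^+$ and $u^-$ denote the elements of $X$ with $\chi(u,u^+,z)=1$ for all $z\in X\setminus\{u^+\}$ and $\chi(u,u^-,z)=-1$ for all $z\in X\setminus\{u^-\}$ (the neighbours of $u$ on the convex hull). Two segments (unordered pairs of elements) $xy$ and $zt$ with four distinct endpoints cross if $\chi(x,y,z)=-\chi(x,y,t)$ and $\chi(z,t,x)=-\chi(z,t,y)$; a triangulation is an inclusion-maximal set of pairwise non-crossing segments. The join $(\chi_1,u_1)\vee(\chi_2,u_2)$ of rooted chirotopes on $X_1\cup\{u_1\}$ and $X_2\cup\{u_2\}$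 is the rooted chirotope $(\chi_3,u_3)$ on $X_3\cup\{u_3\}$, where $X_3$ is the disjoint union of $X_1$ and $X_2$ with $u_1^-$ and $u_2^+$ identified, and $\chi_3$ is the alternating map such that for $x,y,z\in X_3$ $$\chi_3(x,y,z)=\begin{cases}\chi_i(x,y,z)&x,y,z\in X_i,\ i=1,2,\\ \chi_1(x,y,u_1)&x,y\in X_1,\ z\in X_2\setminus\{u_2^+\},\\ \chi_2(u_2,y,z)&x\in X_1\setminus\{u_1^-\},\ y,z\in X_2,\end{cases}$$ $$\chi_3(x,y,u_3)=\begin{cases}\chi_i(x,y,u_i)&x,y\in X_i,\ i=1,2,\\ 1&x\in X_1\setminus\{u_1^-\},\ y\in X_2\setminus\{u_2^+\}.\end{cases}$$ Let $(\chi_1,u_1)$ be the rooted chirotope of four points in the plane, one of them inside the triangle formed by the other three, rooted at an external point, and let $(\chi_{k+1},u_{k+1})=(\chi_k,u_k)\vee(\chi_1,u_1)$ for $k\ge1$. Let $Q_k(u)=\sum_{\Delta}u^{\deg_\Delta(u_k)}$, where the sum is over all triangulations $\Delta$ of $\chi_k$ and $\deg_\Delta(u_k)$ is the number of segments of $\Delta$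 that contain the root $u_k$, and let $$F(z,u)=\sum_{k\ge1}Q_k(u)\,z^k .$$ **Proposition.** The series $F(z,u)$ converges for all $(z,u)\in\mathbb C^2$ with $|z|\max(|u|^2,1)<\tfrac1{900}$, and $\partial_uF(z,1)$ exists for $|z|<\tfrac1{900}$. There exists $R>1/12$ such that the functions $F(z,1)$ and $\partial_uF(z,1)$, defined for $|z|<\tfrac1{900}$, admit analytic continuations to $$D_F=\{z\in\mathbb C:|z|<R\}\setminus[1/12,+\infty).$$ Moreover, as $z\to1/12$ in $D_F$, these continuations satisfy $$F(z,1)=c_1-c_2\sqrt{1-12z}+O(1-12z),\qquad \partial_uF(z,1)=d_1-d_2\sqrt{1-12z}+O(1-12z),$$ where $\sqrt{\cdot}$ is the principal branch of the square root and $$c_1=\frac{-13+3\sqrt{21}}{7-\sqrt{21}},\quad c_2=\frac{12}{7}\,\frac{\sqrt{21}\,(5-\sqrt{21})}{(7-\sqrt{21})^2},\quad d_1=\frac{53-11\sqrt{21}}{7-\sqrt{21}},\quad d_2=4c_2 .$$ -/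

import Mathlib

open Filter Topology Asymptotics

namespace DoubleCircle

/-- A (simple) rooted chirotope. The ground set is `Option X`: the root `u` is `none`, and the
non-root elements are the `some x` with `x : X`. The map `sgn` is the orientation map, with values
`±1` on triples of distinct elements, extended by zero to triples with a repetition; `rotate` and
`swap` are the symmetry axiom. In the interiority and transitivity axioms the hypotheses force the
elements to be distinct. The elements `succ` and `pred` are `u⁺` and `u⁻`, the neighbours of `u` on
the convex hull in counterclockwise order; each is determined by its property (when `X` has one
element they coincide), and either of them witnesses that `u` is extreme. -/
structure RootedChirotope where
  X : Type
  [fintypeX : Fintype X]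
  [decEqX : DecidableEq X]
  sgn : Option X → Option X → Option X → SignType
  ne_zero : ∀ a b c, a ≠ b → b ≠ c → a ≠ c → sgn a b c ≠ 0
  rotate : ∀ a b c, sgn b c a = sgn a b c
  swap : ∀ a b c, sgn b a c = -sgn a b c
  interiority : ∀ t x y z, sgn t y z = 1 → sgn x t z = 1 → sgn x y t = 1 → sgn x y z = 1
  transitivity : ∀ t s x y z, sgn t s x = 1 → sgn t s y = 1 → sgn t s z = 1 →
    sgn x y t = 1 → sgn y z t = 1 → sgn x z t = 1
  succ : X
  pred : X
  sgn_succ : ∀ z, z ≠ succ → sgn none (some succ) (some z) = 1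
  sgn_pred : ∀ z, z ≠ pred → sgn none (some pred) (some z) = -1

attribute [instance] RootedChirotope.fintypeX RootedChirotope.decEqX

/-! ### Triangulations and the triangulation polynomial -/

namespace RootedChirotope

variable (A : RootedChirotope)

/-- The segments `xy` and `zt`, with four distinct endpoints, cross. -/
def Crosses (x y z t : Option A.X) : Prop :=
  x ≠ z ∧ x ≠ t ∧ y ≠ z ∧ y ≠ t ∧
    A.sgn x y z = -A.sgn x y t ∧ A.sgn z t x = -A.sgn z t y

/-- A family of segments (unordered pairs of distinct elements of the ground set) is the same
thing as a simple graph on the ground set. It is non-crossing if no two of its members cross. -/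
def NonCrossing (T : SimpleGraph (Option A.X)) : Prop :=
  ∀ x y z t, T.Adj x y → T.Adj z t → ¬ A.Crosses x y z t

/-- A triangulation is an inclusion-maximal non-crossing family of segments. -/
def IsTriangulation (T : SimpleGraph (Option A.X)) : Prop :=
  Maximal A.NonCrossing T

open Classical in
/-- `∑_T u ^ deg_T(root)`, the sum being over all triangulations `T`. -/
noncomputable def triangulationPoly : Polynomial ℕ :=
  ∑ T : SimpleGraph (Option A.X) with A.IsTriangulation T, Polynomial.X ^ T.degree none

end RootedChirotope

/-! ### The join -/

section Join

variable (A B : RootedChirotope)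

/-- The disjoint union of the non-root elements of `A` and `B` in which `u_A⁻` and `u_B⁺` are
identified: the copy of `u_B⁺` is dropped, so that `inl A.pred` is the common element. -/
abbrev JoinX : Type := A.X ⊕ {y : B.X // y ≠ B.succ}

/-- Elements of `A` are kept, the root and the elements of `B` outside `A` become the root. -/
def toLeft : Option (JoinX A B) → Option A.X
  | some (.inl x) => some x
  | _ => none

/-- Elements of `B` (including the common one) are kept, the root and the elements of `A`
outside `B` become the root. -/
def toRight : Option (JoinX A B) → Option B.X
  | some (.inl x) => if x = A.pred then some B.succ else none
  | some (.inr y) => some y.1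
  | none => none

/-- The sign function of the join. If two arguments `x, y` come from `A`, the third one is kept if
it is in `A` and replaced by the root `u_A` otherwise; similarly for two arguments from `B`
(the common element counts as an element of `B` here). If `x` is in `A`, `y` is in `B` and the
third one is the root, then the orientation of `(x, y, u)` is `1`. -/
def joinSgn : Option (JoinX A B) → Option (JoinX A B) → Option (JoinX A B) → SignType
  | some (.inl x), some (.inl y), c => A.sgn (some x) (some y) (toLeft A B c)
  | some (.inl x), b, some (.inl z) => A.sgn (some x) (toLeft A B b) (some z)
  | a, some (.inl y), some (.inl z) => A.sgn (toLeft A B a) (some y) (some z)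
  | some (.inr x), some (.inr y), c => B.sgn (some x.1) (some y.1) (toRight A B c)
  | some (.inr x), b, some (.inr z) => B.sgn (some x.1) (toRight A B b) (some z.1)
  | a, some (.inr y), some (.inr z) => B.sgn (toRight A B a) (some y.1) (some z.1)
  | some (.inl _), some (.inr _), none => 1
  | some (.inr _), none, some (.inl _) => 1
  | none, some (.inl _), some (.inr _) => 1
  | some (.inr _), some (.inl _), none => -1
  | some (.inl _), none, some (.inr _) => -1
  | none, some (.inr _), some (.inl _) => -1
  | _, _, _ => 0

end Join

namespace RootedChirotope

variable (A : RootedChirotope)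

theorem sgn_self₁₂ (a b : Option A.X) : A.sgn a a b = 0 := by
  have h := A.swap a a b
  revert h
  generalize A.sgn a a b = s
  revert s
  decide

theorem root_trans (x y z : A.X) (h₁ : A.sgn (some x) (some y) none = 1)
    (h₂ : A.sgn (some y) (some z) none = 1) : A.sgn (some x) (some z) none = 1 := by
  have h := A.transitivity none (some A.succ) (some x) (some y) (some z)
  have a1 := A.rotate
  have a2 := A.swap
  have a3 := A.sgn_succ
  have a4 := A.sgn_self₁₂
  have o : (1 : SignType) ≠ -1 := by decide
  have o' : (0 : SignType) ≠ 1 := by decide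
  by_cases hx : x = A.succ <;> by_cases hy : y = A.succ <;> by_cases hz : z = A.succ <;> grind

end RootedChirotope

theorem joinSgn_interiority (A B : RootedChirotope) (t x y z : Option (JoinX A B)) :
    joinSgn A B t y z = 1 → joinSgn A B x t z = 1 → joinSgn A B x y t = 1 →
      joinSgn A B x y z = 1 := by
  have hA := A.interiority
  have hB := B.interiority
  have a1 := A.rotate
  have a2 := A.swap
  have b1 := B.rotate
  have b2 := B.swap
  have b3 := B.sgn_succ
  have o : (-1 : SignType) ≠ 1 := by decide
  have o' : (0 : SignType) ≠ 1 := by decide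
  have o'' : -(-1 : SignType) = 1 := by decide
  revert t x y z
  rintro (_ | t | t) (_ | x | x) (_ | y | y) (_ | z | z) <;>
    simp only [joinSgn, toLeft, toRight, o, o', implies_true, IsEmpty.forall_iff] <;>
    first
      | exact hA _ _ _ _
      | exact hB _ _ _ _
      | (clear hA hB; intros; grind)

set_option maxHeartbeats 4000000 in
theorem joinSgn_transitivity (A B : RootedChirotope) (t s x y z : Option (JoinX A B)) :
    joinSgn A B t s x = 1 → joinSgn A B t s y = 1 → joinSgn A B t s z = 1 →
      joinSgn A B x y t = 1 → joinSgn A B y z t = 1 → joinSgn A B x z t = 1 := by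
  have hA := A.transitivity
  have hB := B.transitivity
  have hA' := A.root_trans
  have hB' := B.root_trans
  have a1 := A.rotate
  have a2 := A.swap
  have a3 := A.sgn_pred
  have b1 := B.rotate
  have b2 := B.swap
  have b3 := B.sgn_succ
  have o : (-1 : SignType) ≠ 1 := by decide
  have o' : (0 : SignType) ≠ 1 := by decide
  have o'' : -(-1 : SignType) = 1 := by decide
  have key : ∀ (t x y : {y : B.X // y ≠ B.succ}) (z : A.X),
      B.sgn (some t.1) none (some x.1) = 1 → B.sgn (some t.1) none (some y.1) = 1 →
      B.sgn (some x.1) (some y.1) (some t.1) = 1 →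
      B.sgn (some y.1) (if z = A.pred then some B.succ else none) (some t.1) = 1 →
      B.sgn (some x.1) (if z = A.pred then some B.succ else none) (some t.1) = 1 := by
    intro t x y z h1 h2 h3 h4
    split_ifs at h4 ⊢
    · have h5 : B.sgn (some t.1) none (some B.succ) = 1 :=
        (b1 _ _ _).symm.trans (b3 t.1 t.2)
      exact hB _ none _ _ _ h1 h2 h5 h3 h4
    · clear hA hB hA' hB'
      grind
  have key' : ∀ s z : A.X, A.sgn none (some s) (some z) = 1 → s ≠ A.pred := by
    rintro s z h rfl
    by_cases hz : z = A.pred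
    · rw [← A.rotate, hz, A.sgn_self₁₂] at h
      exact o' h
    · rw [a3 z hz] at h
      exact o h
  revert t s x y z
  rintro (_ | t | t) (_ | s | s) (_ | x | x) (_ | y | y) (_ | z | z) <;>
    simp only [joinSgn, toLeft, toRight, o, o', implies_true, IsEmpty.forall_iff] <;>
    first
      | exact hA _ _ _ _ _
      | exact hB _ _ _ _ _
      | exact fun _ _ _ => hA' _ _ _
      | exact fun h1 h2 _ => key _ _ _ _ h1 h2
      | (clear hA hB hA' hB' key key'; intros; grind)
      | (clear hA hB hA' key key'; intros; grind)
      | (clear hA hA' hB' key key'; intros; grind)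
      | (intro h1 h2 h3
         have hs : s ≠ A.pred := key' s z h3
         rw [if_neg hs] at h1 h2
         exact key _ _ _ _ h1 h2)

/-- The join `(A, u_A) ∨ (B, u_B)`. -/
def join (A B : RootedChirotope) : RootedChirotope where
  X := JoinX A B
  sgn := joinSgn A B
  ne_zero := by
    have key : ∀ (x : A.X) (y : {y : B.X // y ≠ B.succ}),
        some y.1 ≠ (if x = A.pred then some B.succ else none : Option B.X) := by
      intro x y
      have := y.2
      split_ifs <;> simp [this]
    rintro (_ | a | a) (_ | b | b) (_ | c | c) hab hbc hac <;>
      simp only [joinSgn, toLeft, toRight] <;>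
      first
        | decide
        | exact absurd rfl hab
        | exact absurd rfl hbc
        | exact absurd rfl hac
        | (apply A.ne_zero <;> simp_all)
        | (apply B.ne_zero <;>
            first
              | exact key _ _
              | exact (key _ _).symm
              | (intro h; simp_all [Subtype.ext_iff]))
  rotate := by
    rintro (_ | a | a) (_ | b | b) (_ | c | c) <;>
      simp only [joinSgn, toLeft, toRight] <;>
      first
        | rfl
        | exact A.rotate _ _ _
        | exact B.rotate _ _ _
  swap := by
    rintro (_ | a | a) (_ | b | b) (_ | c | c) <;>
      simp only [joinSgn, toLeft, toRight] <;>
      first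
        | rfl
        | exact A.swap _ _ _
        | exact B.swap _ _ _
  interiority := joinSgn_interiority A B
  transitivity := joinSgn_transitivity A B
  succ := .inl A.succ
  pred := if h : B.pred = B.succ then .inl A.pred else .inr ⟨B.pred, h⟩
  sgn_succ := by
    rintro (z | z) hz
    · exact A.sgn_succ z fun h => hz (congrArg _ h)
    · rfl
  sgn_pred := by
    intro z hz
    split_ifs at hz ⊢ with h
    · rcases z with z | z
      · exact A.sgn_pred z fun h' => hz (congrArg _ h')
      · have h1 := B.sgn_succ z.1 z.2
        have h2 := B.sgn_pred z.1 (by rw [h]; exact z.2)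
        rw [h, h1] at h2
        exact absurd h2 (by decide)
    · rcases z with z | z
      · rfl
      · exact B.sgn_pred z.1 fun h' => hz (congrArg Sum.inr (Subtype.ext h'))

/-! ### The rooted chirotopes obtained from a triangle with an interior point -/

/-- The root `(0, 2)` and the points `(-1, -1)`, `(0, 0)`, `(1, -1)`: the point `(0, 0)` is inside
the triangle formed by the other three. -/
def basePoint : Option (Fin 3) → ℤ × ℤ
  | none => (0, 2)
  | some 0 => (-1, -1)
  | some 1 => (0, 0)
  | some 2 => (1, -1)

/-- The orientation of a triple of points: `1` if it is in counterclockwise order, `-1` if it is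
in clockwise order. -/
noncomputable def orient (p q r : ℤ × ℤ) : SignType :=
  SignType.sign ((q.1 - p.1) * (r.2 - p.2) - (q.2 - p.2) * (r.1 - p.1))

set_option maxRecDepth 20000 in
/-- Four points, one being inside the triangle formed by the other three, with an external point
as the root. -/
noncomputable def base : RootedChirotope where
  X := Fin 3
  sgn a b c := orient (basePoint a) (basePoint b) (basePoint c)
  ne_zero := by decide
  rotate := by decide
  swap := by decide
  interiority := by decide
  transitivity := by decide
  succ := 0
  pred := 2
  sgn_succ := by decide
  sgn_pred := by decide

/-- `chi n` is the rooted chirotope `(χ_{n+1}, u_{n+1})`, where `χ_1` is `base` and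
`χ_{k+1} = χ_k ∨ χ_1`. -/
noncomputable def chi : ℕ → RootedChirotope
  | 0 => base
  | n + 1 => join (chi n) base

/-- `Q n` is the polynomial `Q_{n+1}` of triangulations of `χ_{n+1}`. -/
noncomputable def Q (n : ℕ) : Polynomial ℕ := (chi n).triangulationPoly

/-- The term `Q_k(u) z ^ k` with `k = n + 1`. -/
noncomputable def Fterm (z u : ℂ) (n : ℕ) : ℂ := Polynomial.aeval u (Q n) * z ^ (n + 1)

/-- `F(z, u) = ∑_{k ≥ 1} Q_k(u) z ^ k`. -/
noncomputable def F (z u : ℂ) : ℂ := ∑' n, Fterm z u n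

/-- The slit disk `{z : |z| < R} \ [1/12, ∞)`. -/
def slitDisk (R : ℝ) : Set ℂ :=
  {z | ‖z‖ < R} \ ((fun x : ℝ => (x : ℂ)) '' Set.Ici (1 / 12))

noncomputable def c₁ : ℝ := (-13 + 3 * √21) / (7 - √21)

noncomputable def c₂ : ℝ := 12 / 7 * (√21 * (5 - √21) / (7 - √21) ^ 2)

noncomputable def d₁ : ℝ := (53 - 11 * √21) / (7 - √21)

noncomputable def d₂ : ℝ := 4 * c₂

end DoubleCircle

/-!
The non-root and root elements of `chi n` can be numbered `0, …, 2 n + 3` in counterclockwise order,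
the root being last, in such a way that a triple is in convex position except that each odd vertex
`2 i + 1` before the root lies just inside the hull edge from `2 i` to `2 i + 2`, an *ear*
(`isNumbering_chi`). Two segments then cross exactly when their endpoints interleave and neither is
an ear (`IsNumbering.crosses_iff`), so that a triangulation of `chi n` consists of all the ears and
of a triangulation of the convex polygon `0, …, 2 n + 3` that uses no ear
(`IsNumbering.aeval_triangulationPoly`).

Cutting such a polygon along the triangle at its base gives a convolution (`W_rec`). It depends on
the parities of the two ends of the base only, which makes it a quadratic system for four generating
functions, `serEE`, `serEO`, `serOE`, `serOO`, and a linear system for the two generating functions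
`rootE u`, `rootO u` that record the degree of the root. Counts are at most Catalan numbers, whence
absolute convergence for `|z| max(|u|², 1) < 1/900`, and the systems can be solved for each such `z`
separately: with `M = 1 + F(z, 1)` they give `1 + 2 z = M⁻² + z (z + 4) M²`, and since `M` is close
to `1`, the branch is forced: `2 M⁻² = 1 + 2 z + √(1 - 12 z)` (`exists_values`). Writing
`w = √(1 - 12 z)` and `σ = √(2 + 4 z + 2 w)`, this reads `1 + F(z, 1) = 2 / σ`. The linear system
expresses `F(z, u)` as a rational function of `u` near `1`, whose derivative at `1` is
`8 / (σ (1 + σ + w)) - 1` (`hasDerivAt_F`).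

The right hand sides are analytic as soon as `1 - 12 z` is off the negative axis and `|z| < 1/4`,
because `w`, `2 + 4 z + 2 w` and `σ` then have positive real part. They are analytic functions of
`w` near `w = 0`, since `z = (1 - w²) / 12`, and their first-order Taylor expansions in `w` are the
asserted asymptotic expansions, as `w² = 1 - 12 z`.
-/

namespace DoubleCircle

/-! ### Triangulations of an interval of vertices -/

/-- The pair `(a, c) = (2 i, 2 i + 2)` cuts off the reflex vertex `2 i + 1`; such a pair is not a
diagonal of the polygon `0, 1, 2, …`. -/
def Ear (a c : ℕ) : Prop := Even a ∧ c = a + 2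

instance (a c : ℕ) : Decidable (Ear a c) := inferInstanceAs (Decidable (Even a ∧ c = a + 2))

/-- `T` is a triangulation of the polygon with vertices `a, a + 1, …, b`, whose odd inner vertices
are reflex. Segments are recorded as increasing pairs, the sides included. Maximality is encoded
locally: each segment that is not a side has an apex. -/
structure IsTri (a b : ℕ) (T : Finset (ℕ × ℕ)) : Prop where
  bound : ∀ c d, (c, d) ∈ T → a ≤ c ∧ c < d ∧ d ≤ b
  not_ear : ∀ c d, (c, d) ∈ T → ¬ Ear c d
  base_mem : (a, b) ∈ T
  nonCrossing : ∀ c d c' d', (c, d) ∈ T → (c', d') ∈ T → c < c' → c' < d → d < d' → False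
  apex : ∀ c d, (c, d) ∈ T → c + 1 < d → ∃ m, (c, m) ∈ T ∧ (m, d) ∈ T

open Classical in
/-- The finite set of all triangulations of the polygon `a, a + 1, …, b`. -/
noncomputable def tri (a b : ℕ) : Finset (Finset (ℕ × ℕ)) :=
  (Finset.Icc a b ×ˢ Finset.Icc a b).powerset.filter (IsTri a b)

theorem mem_tri {a b : ℕ} {T : Finset (ℕ × ℕ)} : T ∈ tri a b ↔ IsTri a b T := by
  simp only [tri, Finset.mem_filter, Finset.mem_powerset, and_iff_right_iff_imp]
  rintro h ⟨c, d⟩ hcd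
  have := h.bound c d hcd
  simp only [Finset.mem_product, Finset.mem_Icc]
  omega

/-- The number of segments of `T` whose larger endpoint is `N`. -/
def deg (N : ℕ) (T : Finset (ℕ × ℕ)) : ℕ := (T.filter (fun p => p.2 = N)).card

/-- The sum of `u ^ deg N T` over the triangulations `T` of the polygon `a, …, b`. -/
noncomputable def W (N : ℕ) (u : ℂ) (a b : ℕ) : ℂ := ∑ T ∈ tri a b, u ^ deg N T

theorem tri_self (a : ℕ) : tri a a = ∅ := by
  ext T
  simp only [mem_tri, Finset.notMem_empty, iff_false]
  intro h
  have := h.bound _ _ h.base_mem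
  omega

theorem tri_ear {a b : ℕ} (h : Ear a b) : tri a b = ∅ := by
  ext T
  simp only [mem_tri, Finset.notMem_empty, iff_false]
  exact fun hT => hT.not_ear _ _ hT.base_mem h

theorem tri_succ (a : ℕ) : tri a (a + 1) = {{(a, a + 1)}} := by
  ext T
  rw [mem_tri, Finset.mem_singleton]
  constructor
  · intro h
    ext ⟨c, d⟩
    rw [Finset.mem_singleton, Prod.mk.injEq]
    constructor
    · intro hcd
      have := h.bound c d hcd
      omega
    · rintro ⟨rfl, rfl⟩
      exact h.base_mem
  · rintro rfl
    constructor <;> simp only [Finset.mem_singleton, Prod.mk.injEq]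
    · intros; omega
    · rintro c d ⟨rfl, rfl⟩ ⟨-, h⟩
      omega
    · intros; omega
    · intros; omega

/-- A triangulation splits at the apex `m` of its base `(a, b)`: every other segment lies on one
side of `m`. -/
theorem IsTri.mem_iff_of_apex {a b m : ℕ} {T : Finset (ℕ × ℕ)} (h : IsTri a b T)
    (h₁ : (a, m) ∈ T) (h₂ : (m, b) ∈ T) {c d : ℕ} (hcd : (c, d) ∈ T) :
    (c = a ∧ d = b) ∨ d ≤ m ∨ m ≤ c := by
  have := h.bound _ _ hcd
  by_contra! hc
  obtain ⟨hc1, hc2, hc3⟩ := hc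
  by_cases hca : c = a
  · exact h.nonCrossing _ _ _ _ hcd h₂ hc3 hc2 (by have := hc1 hca; omega)
  · exact h.nonCrossing _ _ _ _ h₁ hcd (by omega) hc3 hc2

theorem IsTri.left {a b m : ℕ} {T : Finset (ℕ × ℕ)} (h : IsTri a b T) (h₁ : (a, m) ∈ T) :
    IsTri a m (T.filter (fun p => p.2 ≤ m)) := by
  constructor <;> simp only [Finset.mem_filter]
  · rintro c d ⟨hcd, hd⟩
    have := h.bound c d hcd
    omega
  · exact fun c d hcd => h.not_ear c d hcd.1
  · exact ⟨h₁, le_rfl⟩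
  · exact fun c d c' d' hcd hcd' => h.nonCrossing c d c' d' hcd.1 hcd'.1
  · rintro c d ⟨hcd, hd⟩ hlt
    obtain ⟨n, hn₁, hn₂⟩ := h.apex c d hcd hlt
    have := h.bound _ _ hn₂
    exact ⟨n, ⟨hn₁, by omega⟩, hn₂, hd⟩

theorem IsTri.right {a b m : ℕ} {T : Finset (ℕ × ℕ)} (h : IsTri a b T) (h₂ : (m, b) ∈ T) :
    IsTri m b (T.filter (fun p => m ≤ p.1)) := by
  constructor <;> simp only [Finset.mem_filter]
  · rintro c d ⟨hcd, hd⟩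
    have := h.bound c d hcd
    omega
  · exact fun c d hcd => h.not_ear c d hcd.1
  · exact ⟨h₂, le_rfl⟩
  · exact fun c d c' d' hcd hcd' => h.nonCrossing c d c' d' hcd.1 hcd'.1
  · rintro c d ⟨hcd, hd⟩ hlt
    obtain ⟨n, hn₁, hn₂⟩ := h.apex c d hcd hlt
    have := h.bound _ _ hn₁
    exact ⟨n, ⟨hn₁, hd⟩, hn₂, by omega⟩

theorem IsTri.glue {a b m : ℕ} {S S' : Finset (ℕ × ℕ)} (hab : ¬ Ear a b) (h : IsTri a m S)
    (h' : IsTri m b S') : IsTri a b (insert (a, b) (S ∪ S')) := by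
  have hb := h.bound
  have hb' := h'.bound
  have hS := hb _ _ h.base_mem
  have hS' := hb' _ _ h'.base_mem
  constructor <;> simp only [Finset.mem_insert, Finset.mem_union, Prod.mk.injEq]
  · rintro c d (⟨rfl, rfl⟩ | hcd | hcd)
    · omega
    · have := hb _ _ hcd; omega
    · have := hb' _ _ hcd; omega
  · rintro c d (⟨rfl, rfl⟩ | hcd | hcd)
    · exact hab
    · exact h.not_ear _ _ hcd
    · exact h'.not_ear _ _ hcd
  · simp
  · rintro c d c' d' (⟨rfl, rfl⟩ | hcd | hcd) (⟨rfl, rfl⟩ | hcd' | hcd') h1 h2 h3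
    · omega
    · have := hb _ _ hcd'; omega
    · have := hb' _ _ hcd'; omega
    · have := hb _ _ hcd; omega
    · exact h.nonCrossing _ _ _ _ hcd hcd' h1 h2 h3
    · have := hb _ _ hcd
      have := hb' _ _ hcd'
      omega
    · have := hb' _ _ hcd; omega
    · have := hb' _ _ hcd
      have := hb _ _ hcd'
      omega
    · exact h'.nonCrossing _ _ _ _ hcd hcd' h1 h2 h3
  · rintro c d (⟨rfl, rfl⟩ | hcd | hcd) hlt
    · exact ⟨m, .inr (.inl h.base_mem), .inr (.inr h'.base_mem)⟩
    · obtain ⟨n, hn₁, hn₂⟩ := h.apex c d hcd hlt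
      exact ⟨n, .inr (.inl hn₁), .inr (.inl hn₂)⟩
    · obtain ⟨n, hn₁, hn₂⟩ := h'.apex c d hcd hlt
      exact ⟨n, .inr (.inr hn₁), .inr (.inr hn₂)⟩

theorem IsTri.filter_glue_left {a b m : ℕ} {S S' : Finset (ℕ × ℕ)} (h : IsTri a m S)
    (h' : IsTri m b S') : (insert (a, b) (S ∪ S')).filter (fun p => p.2 ≤ m) = S := by
  have hS' := h'.bound _ _ h'.base_mem
  ext ⟨c, d⟩
  simp only [Finset.mem_insert, Finset.mem_union, Prod.mk.injEq, Finset.mem_filter]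
  constructor
  · rintro ⟨⟨rfl, rfl⟩ | hcd | hcd, hd⟩
    · omega
    · exact hcd
    · have := h'.bound _ _ hcd; omega
  · exact fun hcd => ⟨.inr (.inl hcd), (h.bound _ _ hcd).2.2⟩

theorem IsTri.filter_glue_right {a b m : ℕ} {S S' : Finset (ℕ × ℕ)} (h : IsTri a m S)
    (h' : IsTri m b S') : (insert (a, b) (S ∪ S')).filter (fun p => m ≤ p.1) = S' := by
  have hS := h.bound _ _ h.base_mem
  ext ⟨c, d⟩
  simp only [Finset.mem_insert, Finset.mem_union, Prod.mk.injEq, Finset.mem_filter]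
  constructor
  · rintro ⟨⟨rfl, rfl⟩ | hcd | hcd, hd⟩
    · omega
    · have := h.bound _ _ hcd; omega
    · exact hcd
  · exact fun hcd => ⟨.inr (.inr hcd), (h'.bound _ _ hcd).1⟩

theorem IsTri.deg_glue {a b m : ℕ} {S S' : Finset (ℕ × ℕ)} (N : ℕ) (h : IsTri a m S)
    (h' : IsTri m b S') :
    deg N (insert (a, b) (S ∪ S')) = (if b = N then 1 else 0) + (deg N S + deg N S') := by
  have hS := h.bound _ _ h.base_mem
  have hS' := h'.bound _ _ h'.base_mem
  have hd : Disjoint S S' := by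
    rw [Finset.disjoint_left]
    rintro ⟨c, d⟩ hc hc'
    have := h.bound _ _ hc
    have := h'.bound _ _ hc'
    omega
  have hn : (a, b) ∉ S ∪ S' := by
    rw [Finset.mem_union]
    rintro (hc | hc)
    · have := h.bound _ _ hc; omega
    · have := h'.bound _ _ hc; omega
  have hu : ((S ∪ S').filter (fun p => p.2 = N)).card = deg N S + deg N S' := by
    rw [Finset.filter_union, Finset.card_union_of_disjoint (Finset.disjoint_filter_filter hd)]
    rfl
  unfold deg at hu ⊢
  rw [Finset.filter_insert]
  split_ifs with hb
  · rw [Finset.card_insert_of_notMem (fun hm => hn (Finset.mem_filter.1 hm).1), hu, add_comm]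
  · rw [hu, zero_add]

/-- Cutting along the triangle at the base of the polygon. The terms `c = a` and `c = b` of the sum
vanish and are there to make it a convolution. -/
theorem W_rec (N : ℕ) (u : ℂ) {a b : ℕ} (hab : a + 1 < b) (he : ¬ Ear a b) :
    W N u a b = (if b = N then u else 1) * ∑ c ∈ Finset.Icc a b, W N u a c * W N u c b := by
  have hW : ∀ c, W N u a c * W N u c b =
      ∑ p ∈ tri a c ×ˢ tri c b, u ^ (deg N p.1 + deg N p.2) := by
    intro c
    rw [W, W, Finset.sum_mul_sum, Finset.sum_product]
    exact Finset.sum_congr rfl fun _ _ => Finset.sum_congr rfl fun _ _ => (pow_add _ _ _).symm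
  simp only [hW]
  rw [Finset.sum_sigma', Finset.mul_sum, W]
  symm
  refine Finset.sum_bij (fun x _ => insert (a, b) (x.2.1 ∪ x.2.2)) ?_ ?_ ?_ ?_
  · rintro ⟨c, S, S'⟩ hx
    simp only [Finset.mem_sigma, Finset.mem_product, mem_tri] at hx ⊢
    exact hx.2.1.glue he hx.2.2
  · rintro ⟨c, S, S'⟩ hx ⟨c', R, R'⟩ hy hxy
    simp only [Finset.mem_sigma, Finset.mem_product, mem_tri] at hx hy hxy
    obtain ⟨-, hS, hS'⟩ := hx
    obtain ⟨-, hR, hR'⟩ := hy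
    have hcc : c = c' := by
      have h1 := hS.glue he hS'
      have m1 : (a, c) ∈ insert (a, b) (S ∪ S') := by simp [hS.base_mem]
      have m2 : (c, b) ∈ insert (a, b) (S ∪ S') := by simp [hS'.base_mem]
      have m3 : (a, c') ∈ insert (a, b) (S ∪ S') := by rw [hxy]; simp [hR.base_mem]
      have m4 : (c', b) ∈ insert (a, b) (S ∪ S') := by rw [hxy]; simp [hR'.base_mem]
      have b1 := hS.bound _ _ hS.base_mem
      have b2 := hS'.bound _ _ hS'.base_mem
      have b3 := hR.bound _ _ hR.base_mem
      have b4 := hR'.bound _ _ hR'.base_mem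
      rcases lt_trichotomy c c' with hlt | heq | hlt
      · exact (h1.nonCrossing _ _ _ _ m3 m2 b1.2.1 hlt b4.2.1).elim
      · exact heq
      · exact (h1.nonCrossing _ _ _ _ m1 m4 b3.2.1 hlt b2.2.1).elim
    subst hcc
    have h1 := hS.filter_glue_left hS'
    have h2 := hS.filter_glue_right hS'
    rw [hxy, hR.filter_glue_left hR'] at h1
    rw [hxy, hR.filter_glue_right hR'] at h2
    rw [h1, h2]
  · intro T hT
    rw [mem_tri] at hT
    obtain ⟨m, h₁, h₂⟩ := hT.apex _ _ hT.base_mem hab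
    have b1 := hT.bound _ _ h₁
    have b2 := hT.bound _ _ h₂
    refine ⟨⟨m, T.filter (fun p => p.2 ≤ m), T.filter (fun p => m ≤ p.1)⟩, ?_, ?_⟩
    · simp only [Finset.mem_sigma, Finset.mem_product, mem_tri, Finset.mem_Icc]
      exact ⟨by omega, hT.left h₁, hT.right h₂⟩
    · ext ⟨c, d⟩
      simp only [Finset.mem_insert, Finset.mem_union, Prod.mk.injEq, Finset.mem_filter]
      constructor
      · rintro (⟨rfl, rfl⟩ | h | h)
        · exact hT.base_mem
        · exact h.1
        · exact h.1
      · intro hcd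
        rcases hT.mem_iff_of_apex h₁ h₂ hcd with h | h | h
        · exact .inl h
        · exact .inr (.inl ⟨hcd, h⟩)
        · exact .inr (.inr ⟨hcd, h⟩)
  · rintro ⟨c, S, S'⟩ hx
    simp only [Finset.mem_sigma, Finset.mem_product, mem_tri] at hx
    rw [hx.2.1.deg_glue N hx.2.2]
    split_ifs <;> simp [pow_add]

theorem W_self (N : ℕ) (u : ℂ) (a : ℕ) : W N u a a = 0 := by simp [W, tri_self]

theorem W_ear (N : ℕ) (u : ℂ) {a b : ℕ} (h : Ear a b) : W N u a b = 0 := by simp [W, tri_ear h]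

theorem W_succ (N : ℕ) (u : ℂ) (a : ℕ) : W N u a (a + 1) = if a + 1 = N then u else 1 := by
  simp only [W, tri_succ, Finset.sum_singleton, deg, Finset.filter_singleton]
  split_ifs <;> simp

/-- The number of triangulations of the polygon `a, …, b`, as the weighted count with weight
`u = 1`, for which the choice of `N` is immaterial. -/
noncomputable def t (a b : ℕ) : ℂ := W 0 1 a b

theorem W_eq_t {N : ℕ} (u : ℂ) {a b : ℕ} (h : b < N) : W N u a b = t a b := by
  unfold t W
  refine Finset.sum_congr rfl fun T hT => ?_
  rw [mem_tri] at hT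
  have : deg N T = 0 := by
    rw [deg, Finset.card_eq_zero, Finset.filter_eq_empty_iff]
    rintro ⟨c, d⟩ hcd
    have := hT.bound _ _ hcd
    dsimp only
    omega
  rw [this, one_pow, pow_zero]

theorem W_one (N a b : ℕ) : W N 1 a b = t a b := by simp [t, W]

theorem ear_add_two {a b : ℕ} : Ear (a + 2) (b + 2) ↔ Ear a b := by
  unfold Ear
  rw [Nat.even_add]
  simp

theorem sum_Icc_eq_sum_range (f : ℕ → ℂ) (a L : ℕ) :
    ∑ c ∈ Finset.Icc a (a + L), f c = ∑ i ∈ Finset.range (L + 1), f (a + i) := by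
  rw [← Finset.Ico_add_one_right_eq_Icc, Finset.sum_Ico_eq_sum_range]
  congr 2
  omega

/-- The weighted counts are invariant under translation by two vertices. -/
theorem W_add_two (N : ℕ) (u : ℂ) (L : ℕ) :
    ∀ a, W (N + 2) u (a + 2) (a + L + 2) = W N u a (a + L) := by
  induction L using Nat.strong_induction_on with
  | _ L ih =>
    intro a
    by_cases he : Ear a (a + L)
    · rw [W_ear _ _ he, W_ear _ _ (ear_add_two.2 he)]
    rcases L with _ | _ | L
    · simp [W_self]
    · have := W_succ (N + 2) u (a + 2)
      rw [show a + 2 + 1 = a + (0 + 1) + 2 by ring] at this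
      rw [this, zero_add, W_succ]
      simp
    · rw [W_rec _ _ (by omega) (fun h => he (ear_add_two.1 h)), W_rec _ _ (by omega) he,
        show a + (L + 1 + 1) + 2 = (a + 2) + (L + 1 + 1) by ring,
        sum_Icc_eq_sum_range, sum_Icc_eq_sum_range]
      congr 1
      · simp [show a + 2 + (L + 1 + 1) = a + (L + 1 + 1) + 2 by ring]
      -- the two extreme terms vanish, the others are covered by the induction hypothesis
      refine Finset.sum_congr rfl fun i hi => ?_
      rw [Finset.mem_range] at hi
      rcases Nat.eq_zero_or_pos i with rfl | hpos
      · simp [W_self]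
      rcases Nat.lt_or_ge i (L + 1 + 1) with hlt | hge
      · have h1 := ih i hlt a
        have h2 := ih (L + 1 + 1 - i) (by omega) (a + i)
        rw [show a + i + (L + 1 + 1 - i) = a + (L + 1 + 1) by omega] at h2
        rw [← h1, ← h2]
        congr 2 <;> omega
      · have : i = L + 1 + 1 := by omega
        subst this
        simp [W_self]

theorem W_add_mul_two (N : ℕ) (u : ℂ) {a b : ℕ} (h : a ≤ b) (j : ℕ) :
    W (N + 2 * j) u (a + 2 * j) (b + 2 * j) = W N u a b := by
  obtain ⟨L, rfl⟩ := Nat.exists_eq_add_of_le h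
  induction j with
  | zero => rfl
  | succ j ih =>
    rw [← ih, show a + L + 2 * j = a + 2 * j + L by ring, ← W_add_two]
    congr 1
    ring

theorem t_add_mul_two {a b : ℕ} (h : a ≤ b) (j : ℕ) : t (a + 2 * j) (b + 2 * j) = t a b := by
  rw [← W_one (0 + 2 * j), ← W_one 0, W_add_mul_two _ _ h]

/-! ### Growth -/

theorem catalan_le_four_pow (n : ℕ) : catalan n ≤ 4 ^ n := by
  rw [catalan_eq_centralBinom_div]
  refine (Nat.div_le_self _ _).trans ?_
  rw [Nat.centralBinom_eq_two_mul_choose]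
  refine (Nat.choose_le_two_pow _ _).trans ?_
  rw [pow_mul]
  norm_num

theorem norm_t_le_catalan (L : ℕ) : ∀ a, ‖t a (a + L + 1)‖ ≤ catalan L := by
  induction L using Nat.strong_induction_on with
  | _ L ih =>
    intro a
    by_cases he : Ear a (a + L + 1)
    · rw [t, W_ear _ _ he, norm_zero]
      positivity
    rcases L with _ | L
    · rw [t, add_zero, W_succ]
      simp
    · rw [← W_one (a + (L + 1) + 2), W_rec _ _ (by omega) he, if_neg (by omega), one_mul,
        catalan_succ', Finset.Nat.sum_antidiagonal_eq_sum_range_succ_mk, Nat.cast_sum,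
        show a + (L + 1) + 1 = a + (L + 2) by ring, sum_Icc_eq_sum_range, Finset.sum_range_succ,
        Finset.sum_range_succ']
      simp only [add_zero, W_self, zero_mul, mul_zero]
      refine norm_sum_le_of_le _ fun i hi => ?_
      rw [Finset.mem_range] at hi
      rw [W_one, W_one, norm_mul, Nat.cast_mul]
      have h1 := ih i (by omega) a
      have h2 := ih (L - i) (by omega) (a + i + 1)
      rw [show a + i + 1 + (L - i) + 1 = a + (L + 2) by omega] at h2
      exact mul_le_mul h1 h2 (norm_nonneg _) (by positivity)

theorem norm_t_le (a L : ℕ) : ‖t a (a + L + 1)‖ ≤ 4 ^ L :=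
  (norm_t_le_catalan L a).trans (by exact_mod_cast catalan_le_four_pow L)

theorem IsTri.deg_le {a b : ℕ} {T : Finset (ℕ × ℕ)} (h : IsTri a b T) (N : ℕ) :
    deg N T ≤ b - a := by
  rw [deg, ← Nat.card_Ico]
  refine Finset.card_le_card_of_injOn Prod.fst ?_ ?_
  · rintro ⟨c, d⟩ hcd
    have := h.bound c d (Finset.mem_filter.1 hcd).1
    simp only [Finset.coe_Ico, Set.mem_Ico]
    omega
  · rintro ⟨c, d⟩ hcd ⟨c', d'⟩ hcd' hcc
    have h1 := (Finset.mem_filter.1 hcd).2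
    have h2 := (Finset.mem_filter.1 hcd').2
    exact Prod.ext hcc (h1.trans h2.symm)

theorem norm_W_le (N : ℕ) (u : ℂ) (a L : ℕ) :
    ‖W N u a (a + L + 1)‖ ≤ 4 ^ L * max ‖u‖ 1 ^ (L + 1) := by
  have hcard : ((tri a (a + L + 1)).card : ℝ) ≤ 4 ^ L := by
    have := norm_t_le a L
    simpa [t, W] using this
  refine (norm_sum_le_of_le _ (f := fun T => u ^ deg N T)
    (n := fun _ => max ‖u‖ 1 ^ (L + 1)) fun T hT => ?_).trans ?_
  · have := (mem_tri.1 hT).deg_le N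
    rw [norm_pow]
    exact (pow_le_pow_left₀ (norm_nonneg _) (le_max_left _ _) _).trans
      (pow_le_pow_right₀ (le_max_right _ _) (by omega))
  · rw [Finset.sum_const, nsmul_eq_mul]
    gcongr

/-! ### Triangulations of the chirotopes as triangulations of polygons -/

/-- A numbering of the elements of `A` by `0, …, N`, the root being last, for which all triples are
in counterclockwise order, except that each odd vertex other than the root is reflex, that is, lies
just inside the hull edge spanned by its two neighbours. The elements are numbered around the
polygon, so `Ear (pos x) (pos z)` forces `y` to be the vertex in between. -/
structure IsNumbering (A : RootedChirotope) (N : ℕ) (pos : Option A.X → ℕ) : Prop where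
  injective : Function.Injective pos
  le : ∀ x, pos x ≤ N
  surjective : ∀ i ≤ N, ∃ x, pos x = i
  root : pos none = N
  odd : Odd N
  sgn : ∀ x y z, pos x < pos y → pos y < pos z →
    A.sgn x y z = if Ear (pos x) (pos z) then -1 else 1

namespace IsNumbering

variable {A : RootedChirotope} {N : ℕ} {pos : Option A.X → ℕ}

theorem not_ear_of_lt {a b c d : ℕ} (h₁ : a < b) (h₂ : b < c) (h₃ : c < d) : ¬ Ear a d := by
  unfold Ear
  omega

theorem crosses_iff_of_lt (h : IsNumbering A N pos) {x y z t : Option A.X} (hxy : pos x < pos y)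
    (hzt : pos z < pos t) (hxz : pos x < pos z) : A.Crosses x y z t ↔
      ¬ Ear (pos x) (pos y) ∧ ¬ Ear (pos z) (pos t) ∧ pos z < pos y ∧ pos y < pos t := by
  have e2 : (-1 : SignType) ≠ 1 := by decide
  have f0 := h.sgn
  -- the sign when the last argument has to be moved to the first or to the middle place
  have f1 : ∀ a b c, pos c < pos a → pos a < pos b →
      A.sgn a b c = if Ear (pos c) (pos b) then -1 else 1 := fun a b c h1 h2 => by
    rw [← h.sgn c a b h1 h2, A.rotate]
  have f2 : ∀ a b c, pos a < pos c → pos c < pos b →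
      A.sgn a b c = -(if Ear (pos a) (pos b) then -1 else 1) := fun a b c h1 h2 => by
    rw [← h.sgn a c b h1 h2, A.rotate, A.swap, ← A.rotate]
  have hne : ∀ a b : Option A.X, a ≠ b ↔ pos a ≠ pos b := fun a b => h.injective.ne_iff.symm
  unfold RootedChirotope.Crosses
  rw [hne, hne, hne, hne]
  rcases lt_trichotomy (pos y) (pos z) with hyz | hyz | hyz
  · rw [f0 x y z hxy hyz, f0 x y t hxy (by omega), f1 z t x hxz hzt, f1 z t y hyz hzt,
      if_neg (not_ear_of_lt hxy hyz hzt)]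
    unfold Ear
    simp only [Nat.even_iff]
    split_ifs <;> simp <;> omega
  · omega
  rcases lt_trichotomy (pos y) (pos t) with hyt | hyt | hyt
  · rw [f2 x y z hxz hyz, f0 x y t hxy hyt, f1 z t x hxz hzt, f2 z t y hyz hyt,
      if_neg (not_ear_of_lt hxz hyz hyt)]
    split_ifs <;> simp [*]
    omega
  · omega
  · rw [f2 x y z hxz hyz, f2 x y t (by omega) hyt, if_neg (not_ear_of_lt hxz hzt hyt)]
    simp only [e2, neg_neg, false_and, and_false, false_iff]
    omega

theorem crosses_comm {x y z t : Option A.X} : A.Crosses x y z t ↔ A.Crosses z t x y := by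
  unfold RootedChirotope.Crosses
  constructor <;> rintro ⟨h1, h2, h3, h4, h5, h6⟩ <;>
    exact ⟨h1.symm, h3.symm, h2.symm, h4.symm, h6, h5⟩

theorem crosses_swap {x y z t : Option A.X} : A.Crosses x y z t ↔ A.Crosses y x z t := by
  unfold RootedChirotope.Crosses
  have h : ∀ a b : SignType, a = -b ↔ b = -a := by decide
  rw [A.swap x y z, A.swap x y t, neg_inj, h (A.sgn z t x)]
  tauto

/-- Two segments cross if and only if their endpoints interleave and neither is an ear: the ears
are edges of the convex hull. -/
theorem crosses_iff (h : IsNumbering A N pos) {x y z t : Option A.X} (hxy : pos x < pos y)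
    (hzt : pos z < pos t) : A.Crosses x y z t ↔
      ¬ Ear (pos x) (pos y) ∧ ¬ Ear (pos z) (pos t) ∧
        (pos x < pos z ∧ pos z < pos y ∧ pos y < pos t ∨
          pos z < pos x ∧ pos x < pos t ∧ pos t < pos y) := by
  rcases lt_trichotomy (pos x) (pos z) with hxz | hxz | hxz
  · rw [h.crosses_iff_of_lt hxy hzt hxz]
    have : ¬ pos z < pos x := by omega
    tauto
  · constructor
    · exact fun hc => absurd (h.injective hxz) hc.1
    · omega
  · rw [crosses_comm, h.crosses_iff_of_lt hzt hxy hxz]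
    have : ¬ pos x < pos z := by omega
    tauto

theorem nonCrossing_iff (h : IsNumbering A N pos) {T : SimpleGraph (Option A.X)} :
    A.NonCrossing T ↔ ∀ x y z t, pos x < pos y → pos z < pos t → T.Adj x y → T.Adj z t →
      ¬ A.Crosses x y z t := by
  refine ⟨fun hT x y z t _ _ => hT x y z t, fun hT x y z t hxy hzt => ?_⟩
  have h1 : pos x ≠ pos y := h.injective.ne hxy.ne
  have h2 : pos z ≠ pos t := h.injective.ne hzt.ne
  rcases lt_or_gt_of_ne h1 with h1 | h1 <;> rcases lt_or_gt_of_ne h2 with h2 | h2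
  · exact hT x y z t h1 h2 hxy hzt
  · rw [crosses_comm, crosses_swap, crosses_comm]
    exact hT x y t z h1 h2 hxy hzt.symm
  · rw [crosses_swap]
    exact hT y x z t h1 h2 hxy.symm hzt
  · rw [crosses_swap, crosses_comm, crosses_swap, crosses_comm]
    exact hT y x t z h1 h2 hxy.symm hzt.symm

/-- A segment that crosses no segment of a triangulation belongs to it. -/
theorem adj_of_forall_not_crosses (h : IsNumbering A N pos) {T : SimpleGraph (Option A.X)}
    (hT : A.IsTriangulation T) {x y : Option A.X} (hxy : pos x < pos y)
    (hc : ∀ z t, pos z < pos t → T.Adj z t → ¬ A.Crosses x y z t) : T.Adj x y := by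
  have hne : x ≠ y := fun h => by rw [h] at hxy; omega
  have hadj : ∀ a b, pos a < pos b → (T ⊔ SimpleGraph.edge x y).Adj a b →
      T.Adj a b ∨ (a = x ∧ b = y) := by
    intro a b hab hadj
    rw [SimpleGraph.sup_adj, SimpleGraph.edge_adj] at hadj
    rcases hadj with hadj | ⟨⟨rfl, rfl⟩ | ⟨rfl, rfl⟩, -⟩
    · exact .inl hadj
    · exact .inr ⟨rfl, rfl⟩
    · omega
  have hnc : A.NonCrossing (T ⊔ SimpleGraph.edge x y) := by
    rw [h.nonCrossing_iff]
    intro a b c d hab hcd h1 h2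
    rcases hadj a b hab h1 with k1 | ⟨rfl, rfl⟩ <;> rcases hadj c d hcd h2 with k2 | ⟨rfl, rfl⟩
    · exact hT.prop a b c d k1 k2
    · rw [crosses_comm]
      exact hc a b hab k1
    · exact hc c d hcd k2
    · exact fun hx => hx.1 rfl
  refine hT.le_of_ge hnc le_sup_left ?_
  rw [SimpleGraph.sup_adj, SimpleGraph.edge_adj]
  exact .inr ⟨.inl ⟨rfl, rfl⟩, hne⟩

theorem adj_of_ear (h : IsNumbering A N pos) {T : SimpleGraph (Option A.X)}
    (hT : A.IsTriangulation T) {x y : Option A.X} (he : Ear (pos x) (pos y)) : T.Adj x y := by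
  have hxy : pos x < pos y := by have := he.2; omega
  refine h.adj_of_forall_not_crosses hT hxy fun z t hzt _ => ?_
  rw [h.crosses_iff hxy hzt]
  exact fun hx => hx.1 he

end IsNumbering

open Classical in
/-- The segments of `T` that are not ears, as pairs of numbers. -/
noncomputable def segs {A : RootedChirotope} (N : ℕ) (pos : Option A.X → ℕ)
    (T : SimpleGraph (Option A.X)) : Finset (ℕ × ℕ) :=
  (Finset.range (N + 1) ×ˢ Finset.range (N + 1)).filter fun p =>
    p.1 < p.2 ∧ ¬ Ear p.1 p.2 ∧ ∃ x y, pos x = p.1 ∧ pos y = p.2 ∧ T.Adj x y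

/-- The graph whose edges are the pairs in `S` and the ears. -/
def ofSegs {A : RootedChirotope} (pos : Option A.X → ℕ) (S : Finset (ℕ × ℕ)) :
    SimpleGraph (Option A.X) where
  Adj x y := pos x < pos y ∧ (Ear (pos x) (pos y) ∨ (pos x, pos y) ∈ S) ∨
    pos y < pos x ∧ (Ear (pos y) (pos x) ∨ (pos y, pos x) ∈ S)
  symm := ⟨fun _ _ h => h.symm⟩
  loopless := ⟨fun x h => by simp at h⟩

/-- A segment of the polygon that interleaves with no segment of a triangulation belongs to it. -/
theorem IsTri.mem_of_forall {a b : ℕ} {S : Finset (ℕ × ℕ)} (hS : IsTri a b S) {c d : ℕ}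
    (hac : a ≤ c) (hcd : c < d) (hdb : d ≤ b)
    (h : ∀ c' d', (c', d') ∈ S →
      ¬ (c < c' ∧ c' < d ∧ d < d' ∨ c' < c ∧ c < d' ∧ d' < d)) : (c, d) ∈ S := by
  -- descend through the triangles that contain the segment
  have key : ∀ n p q, q - p = n → (p, q) ∈ S → p ≤ c → d ≤ q → (c, d) ∈ S := by
    intro n
    induction n using Nat.strong_induction_on with
    | _ n ih =>
      intro p q hn hpq hp hq
      by_cases heq : p = c ∧ q = d
      · rwa [← heq.1, ← heq.2]
      obtain ⟨m, h1, h2⟩ := hS.apex p q hpq (by omega)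
      have b1 := hS.bound _ _ h1
      have b2 := hS.bound _ _ h2
      have i1 := h _ _ h1
      have i2 := h _ _ h2
      by_cases hd : d ≤ m
      · exact ih (m - p) (by omega) p m rfl h1 hp hd
      by_cases hc : m ≤ c
      · exact ih (q - m) (by omega) m q rfl h2 hc hq
      omega
  exact key _ a b rfl hS.base_mem hac hdb

namespace IsNumbering

variable {A : RootedChirotope} {N : ℕ} {pos : Option A.X → ℕ}

theorem mem_segs (h : IsNumbering A N pos) {T : SimpleGraph (Option A.X)} {x y : Option A.X} :
    (pos x, pos y) ∈ segs N pos T ↔ pos x < pos y ∧ ¬ Ear (pos x) (pos y) ∧ T.Adj x y := by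
  simp only [segs, Finset.mem_filter, Finset.mem_product, Finset.mem_range]
  have := h.le x
  have := h.le y
  constructor
  · rintro ⟨-, hlt, he, x', y', hx, hy, hadj⟩
    rw [← h.injective hx, ← h.injective hy]
    exact ⟨by rwa [hx, hy], by rwa [hx, hy], hadj⟩
  · exact fun ⟨h1, h2, h3⟩ => ⟨by omega, h1, h2, x, y, rfl, rfl, h3⟩

theorem exists_of_mem_segs {T : SimpleGraph (Option A.X)} {c d : ℕ}
    (hcd : (c, d) ∈ segs N pos T) : ∃ x y, pos x = c ∧ pos y = d := by
  simp only [segs, Finset.mem_filter] at hcd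
  obtain ⟨-, -, -, x, y, hx, hy, -⟩ := hcd
  exact ⟨x, y, hx, hy⟩

theorem isTri_segs (h : IsNumbering A N pos) {T : SimpleGraph (Option A.X)}
    (hT : A.IsTriangulation T) : IsTri 0 N (segs N pos T) := by
  have bound : ∀ c d, (c, d) ∈ segs N pos T → 0 ≤ c ∧ c < d ∧ d ≤ N := by
    intro c d hcd
    obtain ⟨x, y, rfl, rfl⟩ := exists_of_mem_segs hcd
    exact ⟨zero_le, (h.mem_segs.1 hcd).1, h.le y⟩
  have not_ear : ∀ c d, (c, d) ∈ segs N pos T → ¬ Ear c d := by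
    intro c d hcd
    obtain ⟨x, y, rfl, rfl⟩ := exists_of_mem_segs hcd
    exact (h.mem_segs.1 hcd).2.1
  have nc : ∀ c d c' d', (c, d) ∈ segs N pos T → (c', d') ∈ segs N pos T →
      c < c' → c' < d → d < d' → False := by
    intro c d c' d' hcd hcd' h1 h2 h3
    obtain ⟨x, y, rfl, rfl⟩ := exists_of_mem_segs hcd
    obtain ⟨z, t, rfl, rfl⟩ := exists_of_mem_segs hcd'
    obtain ⟨m1, m2, m3⟩ := h.mem_segs.1 hcd
    obtain ⟨n1, n2, n3⟩ := h.mem_segs.1 hcd'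
    exact hT.prop x y z t m3 n3 ((h.crosses_iff m1 n1).2 ⟨m2, n2, .inl ⟨h1, h2, h3⟩⟩)
  have maxl : ∀ c d, c < d → d ≤ N → ¬ Ear c d → (∀ c' d', (c', d') ∈ segs N pos T →
      c' < d' → ¬ (c < c' ∧ c' < d ∧ d < d' ∨ c' < c ∧ c < d' ∧ d' < d)) →
      (c, d) ∈ segs N pos T := by
    intro c d hcd hd he hc
    obtain ⟨x, rfl⟩ := h.surjective c (by omega)
    obtain ⟨y, rfl⟩ := h.surjective d hd
    refine h.mem_segs.2 ⟨hcd, he, h.adj_of_forall_not_crosses hT hcd fun z t hzt hadj hx => ?_⟩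
    rw [h.crosses_iff hcd hzt] at hx
    exact hc _ _ (h.mem_segs.2 ⟨hzt, hx.2.1, hadj⟩) hzt hx.2.2
  have side : ∀ c, c + 1 ≤ N → (c, c + 1) ∈ segs N pos T := by
    intro c hc
    refine maxl c (c + 1) (by omega) hc (fun he => ?_) fun c' d' _ _ => by omega
    have := he.2
    omega
  refine ⟨bound, not_ear, ?_, nc, ?_⟩
  · have := h.odd
    refine maxl 0 N this.pos le_rfl (fun he => ?_) fun c' d' hm _ => ?_
    · rw [he.2] at this
      exact absurd this (by decide)
    · have := bound _ _ hm
      omega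
  intro c d hcd hlt
  have hb := bound _ _ hcd
  -- the apex is the last neighbour of `c` before `d`
  classical
  let p : ℕ → Prop := fun m => m < d ∧ (c, m) ∈ segs N pos T
  have hp : p (c + 1) := ⟨hlt, side c (by omega)⟩
  obtain ⟨hmd, hcm⟩ : p (Nat.findGreatest p d) := Nat.findGreatest_spec (by omega) hp
  have hmax : ∀ e, Nat.findGreatest p d < e → e < d → (c, e) ∉ segs N pos T :=
    fun e h1 h2 h3 => Nat.findGreatest_is_greatest h1 h2.le ⟨h2, h3⟩
  generalize Nat.findGreatest p d = m at hmd hcm hmax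
  have hcm' := bound _ _ hcm
  refine ⟨m, hcm, ?_⟩
  by_cases he : Ear m d
  · -- otherwise `d - 1` would be a later neighbour of `c`
    obtain ⟨he1, he2⟩ := he
    refine absurd (maxl c (d - 1) (by omega) (by omega) ?_ fun c' d' hm hlt' hx => ?_)
      (hmax (d - 1) (by omega) (by omega))
    · rintro ⟨h1, h2⟩
      rw [Nat.even_iff] at he1 h1
      omega
    · rcases hx with hx | hx
      · rcases lt_trichotomy d' d with h1 | h1 | h1
        · omega
        · subst h1
          rcases lt_trichotomy c' m with h2 | h2 | h2
          · exact nc _ _ _ _ hcm hm hx.1 h2 hmd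
          · subst h2
            exact not_ear _ _ hm ⟨he1, he2⟩
          · omega
        · exact nc _ _ _ _ hcd hm hx.1 (by omega) h1
      · exact nc _ _ _ _ hm hcd hx.1 hx.2.1 (by omega)
  · refine maxl m d hmd (by omega) he fun c' d' hm hlt' hx => ?_
    rcases hx with hx | hx
    · exact nc _ _ _ _ hcd hm (by omega) hx.2.1 hx.2.2
    · rcases lt_trichotomy c' c with h1 | h1 | h1
      · exact nc _ _ _ _ hm hcd h1 (by omega) hx.2.2
      · subst h1
        exact hmax d' hx.2.1 hx.2.2 hm
      · exact nc _ _ _ _ hcm hm h1 hx.1 hx.2.1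

theorem ofSegs_adj_of_lt {S : Finset (ℕ × ℕ)} {x y : Option A.X} (hxy : pos x < pos y) :
    (ofSegs pos S).Adj x y ↔ Ear (pos x) (pos y) ∨ (pos x, pos y) ∈ S := by
  simp [ofSegs, hxy, hxy.not_gt]

theorem isTriangulation_ofSegs (h : IsNumbering A N pos) {S : Finset (ℕ × ℕ)}
    (hS : IsTri 0 N S) : A.IsTriangulation (ofSegs pos S) := by
  refine ⟨?_, ?_⟩
  · rw [h.nonCrossing_iff]
    intro x y z t hxy hzt h1 h2 hx
    rw [h.crosses_iff hxy hzt] at hx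
    have h1 := ((ofSegs_adj_of_lt hxy).1 h1).resolve_left hx.1
    have h2 := ((ofSegs_adj_of_lt hzt).1 h2).resolve_left hx.2.1
    rcases hx.2.2 with hx | hx
    · exact hS.nonCrossing _ _ _ _ h1 h2 hx.1 hx.2.1 hx.2.2
    · exact hS.nonCrossing _ _ _ _ h2 h1 hx.1 hx.2.1 hx.2.2
  · intro T' hT' hle
    have key : ∀ x y, pos x < pos y → T'.Adj x y → (ofSegs pos S).Adj x y := by
      intro x y hxy hadj
      rw [ofSegs_adj_of_lt hxy]
      by_cases he : Ear (pos x) (pos y)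
      · exact .inl he
      refine .inr (hS.mem_of_forall zero_le hxy (h.le y) fun c d hcd hx => ?_)
      have hb := hS.bound _ _ hcd
      obtain ⟨z, rfl⟩ := h.surjective c (by omega)
      obtain ⟨t, rfl⟩ := h.surjective d (by omega)
      refine hT' x y z t hadj (hle ((ofSegs_adj_of_lt hb.2.1).2 (.inr hcd))) ?_
      exact (h.crosses_iff hxy hb.2.1).2 ⟨he, hS.not_ear _ _ hcd, hx⟩
    intro x y hadj
    rcases lt_or_gt_of_ne (h.injective.ne hadj.ne) with hlt | hlt
    · exact key x y hlt hadj
    · exact (key y x hlt hadj.symm).symm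

theorem segs_ofSegs (h : IsNumbering A N pos) {S : Finset (ℕ × ℕ)} (hS : IsTri 0 N S) :
    segs N pos (ofSegs pos S) = S := by
  ext ⟨c, d⟩
  constructor
  · intro hcd
    obtain ⟨x, y, rfl, rfl⟩ := exists_of_mem_segs hcd
    obtain ⟨h1, h2, h3⟩ := h.mem_segs.1 hcd
    exact ((ofSegs_adj_of_lt h1).1 h3).resolve_left h2
  · intro hcd
    have hb := hS.bound _ _ hcd
    obtain ⟨x, rfl⟩ := h.surjective c (by omega)
    obtain ⟨y, rfl⟩ := h.surjective d (by omega)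
    exact h.mem_segs.2 ⟨hb.2.1, hS.not_ear _ _ hcd, (ofSegs_adj_of_lt hb.2.1).2 (.inr hcd)⟩

theorem segs_injOn (h : IsNumbering A N pos) {T T' : SimpleGraph (Option A.X)}
    (hT : A.IsTriangulation T) (hT' : A.IsTriangulation T')
    (heq : segs N pos T = segs N pos T') : T = T' := by
  have key : ∀ x y, pos x < pos y → (T.Adj x y ↔ T'.Adj x y) := by
    intro x y hxy
    by_cases he : Ear (pos x) (pos y)
    · exact iff_of_true (h.adj_of_ear hT he) (h.adj_of_ear hT' he)
    · have h1 := h.mem_segs (T := T) (x := x) (y := y)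
      have h2 := h.mem_segs (T := T') (x := x) (y := y)
      rw [heq] at h1
      tauto
  ext x y
  rcases lt_trichotomy (pos x) (pos y) with hlt | heq | hlt
  · exact key x y hlt
  · rw [h.injective heq]
    simp
  · rw [T.adj_comm, T'.adj_comm, key y x hlt]

open Classical in
theorem degree_root (h : IsNumbering A N pos) (T : SimpleGraph (Option A.X)) :
    T.degree none = deg N (segs N pos T) := by
  rw [← SimpleGraph.card_neighborFinset_eq_degree, deg]
  have hear : ∀ x : Option A.X, ¬ Ear (pos x) N := by
    rintro x ⟨h1, h2⟩
    have := h.odd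
    rw [Nat.odd_iff] at this
    rw [Nat.even_iff] at h1
    omega
  refine Finset.card_bij (fun x _ => (pos x, N)) ?_ ?_ ?_
  · intro x hx
    rw [SimpleGraph.mem_neighborFinset] at hx
    have h1 : pos x ≠ pos none := h.injective.ne hx.ne'
    have h2 := h.le x
    rw [h.root] at h1
    rw [Finset.mem_filter]
    refine ⟨?_, rfl⟩
    have := (h.mem_segs (T := T) (x := x) (y := none)).2
    rw [h.root] at this
    exact this ⟨by omega, hear x, hx.symm⟩
  · intro x _ y _ hxy
    exact h.injective (Prod.mk.inj hxy).1
  · rintro ⟨c, d⟩ hcd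
    obtain ⟨hcd, hd⟩ := Finset.mem_filter.1 hcd
    obtain ⟨x, y, rfl, rfl⟩ := exists_of_mem_segs hcd
    obtain ⟨h1, h2, h3⟩ := h.mem_segs.1 hcd
    have hy : y = none := h.injective (hd.trans h.root.symm)
    subst hy
    refine ⟨x, ?_, by rw [h.root]⟩
    rw [SimpleGraph.mem_neighborFinset]
    exact h3.symm

/-- The triangulation polynomial of a numbered chirotope is a weighted count of triangulations of
a polygon without ears. -/
theorem aeval_triangulationPoly (h : IsNumbering A N pos) (u : ℂ) :
    Polynomial.aeval u A.triangulationPoly = W N u 0 N := by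
  classical
  rw [RootedChirotope.triangulationPoly, map_sum, W]
  refine Finset.sum_bij (fun T _ => segs N pos T) ?_ ?_ ?_ ?_
  · intro T hT
    exact mem_tri.2 (h.isTri_segs (Finset.mem_filter.1 hT).2)
  · intro T hT T' hT' heq
    exact h.segs_injOn (Finset.mem_filter.1 hT).2 (Finset.mem_filter.1 hT').2 heq
  · intro S hS
    rw [mem_tri] at hS
    exact ⟨ofSegs pos S, Finset.mem_filter.2 ⟨Finset.mem_univ _, h.isTriangulation_ofSegs hS⟩,
      h.segs_ofSegs hS⟩
  · intro T _
    rw [map_pow, Polynomial.aeval_X, ← h.degree_root]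

end IsNumbering

/-! ### The numbering of the iterated joins -/

/-- The numbering of the join of `A` and `base` that extends the numbering `pos` of `A`, in which
the root has the number `2 * n + 3`: the elements of `base` come after those of `A`, and the new
root takes the last place. -/
noncomputable def joinPos {A : RootedChirotope} (n : ℕ) (pos : Option A.X → ℕ) :
    Option (JoinX A base) → ℕ
  | none => 2 * n + 5
  | some (.inl x) => pos (some x)
  | some (.inr y) => 2 * n + 2 + (show Fin 3 from y.1).val

/-- The numbering of `chi n`. -/
noncomputable def chiPos : ∀ n, Option (chi n).X → ℕ
  | 0 => fun (x : Option (Fin 3)) => x.elim 3 (fun i => i)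
  | n + 1 => joinPos n (chiPos n)

theorem isNumbering_base : IsNumbering base 3 (chiPos 0) where
  injective := by
    change Function.Injective (fun x : Option (Fin 3) => x.elim 3 (fun i => (i : ℕ)))
    decide
  le := by
    change ∀ x : Option (Fin 3), x.elim 3 (fun i => (i : ℕ)) ≤ 3
    decide
  surjective := by
    change ∀ i ≤ 3, ∃ x : Option (Fin 3), x.elim 3 (fun i => (i : ℕ)) = i
    decide
  root := rfl
  odd := by decide
  sgn := by
    change ∀ x y z : Option (Fin 3), x.elim 3 (fun i => (i : ℕ)) < y.elim 3 (fun i => (i : ℕ)) →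
      y.elim 3 (fun i => (i : ℕ)) < z.elim 3 (fun i => (i : ℕ)) →
      orient (basePoint x) (basePoint y) (basePoint z) =
        if Ear (x.elim 3 (fun i => (i : ℕ))) (z.elim 3 (fun i => (i : ℕ))) then -1 else 1
    decide

/-- Joining a copy of `base` to a numbered chirotope adds two vertices before the root. -/
theorem IsNumbering.join_base {A : RootedChirotope} {n : ℕ} {pos : Option A.X → ℕ}
    (h : IsNumbering A (2 * n + 3) pos) (hpred : pos (some A.pred) = 2 * n + 2) :
    IsNumbering (join A base) (2 * n + 5) (joinPos n pos) := by
  have hle : ∀ x : A.X, pos (some x) ≤ 2 * n + 2 := by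
    intro x
    have h1 := h.le (some x)
    have h2 : pos (some x) ≠ pos none := h.injective.ne (by simp)
    rw [h.root] at h2
    omega
  have hinj : ∀ x y : A.X, pos (some x) = pos (some y) ↔ x = y := fun x y => by
    rw [h.injective.eq_iff, Option.some_inj]
  have hlt : ∀ x : A.X, pos (some x) < 2 * n + 2 ↔ x ≠ A.pred := by
    intro x
    have h1 := hinj x A.pred
    have h2 := hle x
    rw [ne_eq, ← h1]
    omega
  have hy : ∀ y : {y : Fin 3 // y ≠ 0}, 1 ≤ (y.1 : ℕ) ∧ (y.1 : ℕ) ≤ 2 := by decide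
  let y₁ : {y : base.X // y ≠ base.succ} := ⟨(1 : Fin 3), show (1 : Fin 3) ≠ 0 by decide⟩
  let y₂ : {y : base.X // y ≠ base.succ} := ⟨(2 : Fin 3), show (2 : Fin 3) ≠ 0 by decide⟩
  have hy₁ : ∀ y : {y : Fin 3 // y ≠ 0}, y.1.val = 1 → y = y₁ :=
    fun y hy => Subtype.ext (Fin.ext hy)
  have hy₂ : ∀ y : {y : Fin 3 // y ≠ 0}, y.1.val = 2 → y = y₂ :=
    fun y hy => Subtype.ext (Fin.ext hy)
  have hbound : ∀ x : Option (JoinX A base), joinPos n pos x ≤ 2 * n + 5 := by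
    rintro (_ | x | x)
    · exact le_rfl
    · have := hle x
      change pos (some x) ≤ 2 * n + 5
      omega
    · have := hy x
      change 2 * n + 2 + (x.1 : Fin 3).val ≤ 2 * n + 5
      omega
  refine ⟨?_, hbound, ?_, rfl, ⟨n + 2, by ring⟩, ?_⟩
  · rintro (_ | x | x) (_ | y | y) hxy
    · rfl
    · have h1 := hle y
      change 2 * n + 5 = pos (some y) at hxy
      omega
    · have h1 := hy y
      change 2 * n + 5 = 2 * n + 2 + (y.1 : Fin 3).val at hxy
      omega
    · have h1 := hle x
      change pos (some x) = 2 * n + 5 at hxy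
      omega
    · rw [(hinj x y).1 hxy]
    · have h1 := hle x
      have h2 := hy y
      change pos (some x) = 2 * n + 2 + (y.1 : Fin 3).val at hxy
      omega
    · have h1 := hy x
      change 2 * n + 2 + (x.1 : Fin 3).val = 2 * n + 5 at hxy
      omega
    · have h1 := hle y
      have h2 := hy x
      change 2 * n + 2 + (x.1 : Fin 3).val = pos (some y) at hxy
      omega
    · change 2 * n + 2 + (x.1 : Fin 3).val = 2 * n + 2 + (y.1 : Fin 3).val at hxy
      have : x = y := Subtype.ext (Fin.ext (by omega))
      rw [this]
  · intro i hi
    rcases Nat.lt_or_ge i (2 * n + 3) with hi' | hi'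
    · obtain ⟨_ | x, hx⟩ := h.surjective i (by omega)
      · rw [h.root] at hx
        omega
      · exact ⟨some (.inl x), hx⟩
    · obtain rfl | rfl | rfl : i = 2 * n + 3 ∨ i = 2 * n + 4 ∨ i = 2 * n + 5 := by omega
      · exact ⟨some (.inr y₁), rfl⟩
      · exact ⟨some (.inr y₂), rfl⟩
      · exact ⟨none, rfl⟩
  · intro x y z hxy hyz
    change joinSgn A base x y z = _
    have hz := hbound z
    rcases x with _ | x | x
    · change 2 * n + 5 < _ at hxy
      omega
    · change pos (some x) < _ at hxy
      change _ = if Ear (pos (some x)) _ then -1 else 1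
      rcases y with _ | y | y
      · change 2 * n + 5 < _ at hyz
        omega
      · change _ < pos (some y) at hxy
        change pos (some y) < _ at hyz
        -- seen from the segment `x y`, everything outside `A` lies where the root of `A` is
        have key : ∀ c, 2 * n + 3 ≤ c →
            A.sgn (some x) (some y) none = if Ear (pos (some x)) c then -1 else 1 := by
          intro c hc
          have h1 := hle y
          rw [h.sgn _ _ _ hxy (by rw [h.root]; omega), h.root, if_neg, if_neg] <;>
          · unfold Ear
            rw [Nat.even_iff]
            omega
        rcases z with _ | z | z
        · exact key _ (by change _ ≤ 2 * n + 5; omega)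
        · exact h.sgn _ _ _ hxy hyz
        · have := hy z
          exact key _ (by change _ ≤ 2 * n + 2 + (z.1 : Fin 3).val; omega)
      · change 2 * n + 2 + (y.1 : Fin 3).val < _ at hyz
        have h1 := hy y
        have h2 := hle x
        rcases z with _ | z | z
        · change 1 = if Ear _ (2 * n + 5) then -1 else 1
          rw [if_neg]
          unfold Ear
          rw [Nat.even_iff]
          omega
        · have := hle z
          change _ < pos (some z) at hyz
          omega
        · change _ < 2 * n + 2 + (z.1 : Fin 3).val at hyz
          have h3 := hy z
          obtain rfl := hy₁ y (by omega)
          obtain rfl := hy₂ z (by omega)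
          change base.sgn (if x = A.pred then some base.succ else none) (some y₁.1) (some y₂.1) =
            if Ear _ (2 * n + 2 + 2) then -1 else 1
          split_ifs with c1 c2 c2
          · change orient (basePoint (some 0)) (basePoint (some 1)) (basePoint (some 2)) = -1
            decide
          · rw [c1, hpred] at c2
            exact absurd ⟨⟨n + 1, by ring⟩, rfl⟩ c2
          · exact absurd c2.2 (by have := (hlt x).2 c1; omega)
          · change orient (basePoint none) (basePoint (some 1)) (basePoint (some 2)) = 1
            decide
    · change 2 * n + 2 + (x.1 : Fin 3).val < _ at hxy
      change _ = if Ear (2 * n + 2 + (x.1 : Fin 3).val) _ then -1 else 1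
      have h1 := hy x
      rcases y with _ | y | y
      · change 2 * n + 5 < _ at hyz
        omega
      · have := hle y
        change _ < pos (some y) at hxy
        omega
      · change _ < 2 * n + 2 + (y.1 : Fin 3).val at hxy
        change 2 * n + 2 + (y.1 : Fin 3).val < _ at hyz
        have h2 := hy y
        rcases z with _ | z | z
        · obtain rfl := hy₁ x (by omega)
          obtain rfl := hy₂ y (by omega)
          change orient (basePoint (some 1)) (basePoint (some 2)) (basePoint none) =
            if Ear (2 * n + 2 + 1) _ then -1 else 1
          rw [if_neg (fun he => by simpa [Nat.even_add] using he.1)]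
          decide
        · have := hle z
          change _ < pos (some z) at hyz
          omega
        · change _ < 2 * n + 2 + (z.1 : Fin 3).val at hyz
          have := hy z
          omega

theorem chiPos_pred (n : ℕ) : chiPos n (some (chi n).pred) = 2 * n + 2 := by
  cases n with
  | zero => rfl
  | succ n =>
    have hne : base.pred ≠ base.succ := show (2 : Fin 3) ≠ 0 by decide
    change joinPos n (chiPos n) (some (if h : base.pred = base.succ then
      .inl (chi n).pred else .inr ⟨base.pred, h⟩)) = _
    rw [dif_neg hne]
    rfl

theorem isNumbering_chi (n : ℕ) : IsNumbering (chi n) (2 * n + 3) (chiPos n) := by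
  induction n with
  | zero => exact isNumbering_base
  | succ n ih => exact ih.join_base (chiPos_pred n)

theorem aeval_Q (u : ℂ) (n : ℕ) : Polynomial.aeval u (Q n) = W (2 * n + 3) u 0 (2 * n + 3) :=
  (isNumbering_chi n).aeval_triangulationPoly u

/-! ### Generating functions of the polygons -/

open PowerSeries

/-- The generating function of the polygons from an even vertex to an even vertex. In all these
series `X` marks two vertices. -/
noncomputable def serEE : PowerSeries ℂ := mk fun n => t 0 (2 * n)

/-- The generating function of the polygons from an even vertex to an odd vertex. -/
noncomputable def serEO : PowerSeries ℂ := mk fun n => t 0 (2 * n + 1)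

/-- The generating function of the polygons from an odd vertex to an even vertex. -/
noncomputable def serOE : PowerSeries ℂ := mk fun n => t 1 (2 * n + 2)

/-- The generating function of the polygons from an odd vertex to an odd vertex. -/
noncomputable def serOO : PowerSeries ℂ := mk fun n => t 1 (2 * n + 1)

/-- The generating function of the polygons from an even vertex to the root, in which `u` marks the
degree of the root. -/
noncomputable def rootE (u : ℂ) : PowerSeries ℂ := mk fun n => W (2 * n + 1) u 0 (2 * n + 1)

/-- The generating function of the polygons from an odd vertex to the root, in which `u` marks the
degree of the root. -/
noncomputable def rootO (u : ℂ) : PowerSeries ℂ := mk fun n => W (2 * n + 1) u 1 (2 * n + 1)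

theorem rootE_one : rootE 1 = serEO := by simp only [rootE, serEO, W_one]

theorem rootO_one : rootO 1 = serOO := by simp only [rootO, serOO, W_one]

theorem sum_range_two_mul_add_one (f : ℕ → ℂ) (n : ℕ) :
    ∑ i ∈ Finset.range (2 * n + 1), f i =
      ∑ j ∈ Finset.range (n + 1), f (2 * j) + ∑ j ∈ Finset.range n, f (2 * j + 1) := by
  induction n with
  | zero => simp
  | succ n ih =>
    rw [show 2 * (n + 1) + 1 = 2 * n + 1 + 1 + 1 by ring, Finset.sum_range_succ,
      Finset.sum_range_succ, ih, Finset.sum_range_succ _ (n + 1),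
      Finset.sum_range_succ (fun j => f (2 * j + 1)) n,
      show 2 * n + 1 + 1 = 2 * (n + 1) by ring]
    ring

theorem coeff_mul_eq_sum_range (f g : PowerSeries ℂ) (n : ℕ) :
    coeff n (f * g) = ∑ j ∈ Finset.range (n + 1), coeff j f * coeff (n - j) g := by
  rw [coeff_mul, Finset.Nat.sum_antidiagonal_eq_sum_range_succ_mk]

theorem coeff_X_mul_eq_sum_range (f g : PowerSeries ℂ) (n : ℕ) :
    coeff n (X * (f * g)) = ∑ j ∈ Finset.range n, coeff j f * coeff (n - 1 - j) g := by
  cases n with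
  | zero => simp
  | succ n => rw [coeff_succ_X_mul, coeff_mul_eq_sum_range, Nat.add_sub_cancel]

theorem not_ear_of_odd {a b : ℕ} (h : ¬ (Even a ∧ Even b)) : ¬ Ear a b := by
  rintro ⟨h1, rfl⟩
  exact h ⟨h1, by simpa [Nat.even_add] using h1⟩

theorem t_rec {a b : ℕ} (hab : a + 1 < b) (he : ¬ Ear a b) :
    t a b = ∑ c ∈ Finset.Icc a b, t a c * t c b := by
  have := W_rec (b + 1) 1 hab he
  simpa only [W_one, ite_self, one_mul] using this

theorem t_succ (a : ℕ) : t a (a + 1) = 1 := by simp [t, W_succ]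

theorem t_self (a : ℕ) : t a a = 0 := W_self _ _ _

theorem rootE_eq (u : ℂ) : rootE u = C u * (1 + serEE * rootE u + serEO * rootO u) := by
  ext n
  rw [coeff_C_mul, map_add, map_add, coeff_mul_eq_sum_range, coeff_mul_eq_sum_range, coeff_one]
  simp only [rootE, serEE, serEO, rootO, coeff_mk]
  rcases Nat.eq_zero_or_pos n with rfl | hn
  · simp [W_self, W_succ, t_self]
  have hz : (0 : ℕ) + (2 * n + 1) = 2 * n + 1 := zero_add _
  rw [W_rec _ _ (by omega) (not_ear_of_odd (by simp)), if_pos rfl, if_neg hn.ne']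
  refine congrArg (u * ·) ?_
  conv_lhs => rw [← hz, sum_Icc_eq_sum_range, Finset.sum_range_succ, sum_range_two_mul_add_one]
  rw [hz, W_self, mul_zero, add_zero, zero_add]
  refine congrArg₂ (· + ·) ?_ ?_
  · refine Finset.sum_congr rfl fun j hj => ?_
    rw [Finset.mem_range] at hj
    rw [zero_add, W_eq_t _ (by omega), ← W_add_mul_two (2 * (n - j) + 1) u (zero_le) j]
    congr 2 <;> omega
  · rw [Finset.sum_range_succ, Nat.sub_self, mul_zero, zero_add, W_self, mul_zero, add_zero]
    refine Finset.sum_congr rfl fun j hj => ?_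
    rw [Finset.mem_range] at hj
    rw [zero_add, W_eq_t _ (by omega), ← W_add_mul_two (2 * (n - j) + 1) u (by omega) j]
    congr 2 <;> omega

theorem rootO_eq (u : ℂ) : rootO u = C u * (X * (serOE * rootE u) + serOO * rootO u) := by
  ext n
  rw [coeff_C_mul, map_add, coeff_X_mul_eq_sum_range, coeff_mul_eq_sum_range]
  simp only [rootE, serOE, serOO, rootO, coeff_mk]
  rcases Nat.eq_zero_or_pos n with rfl | hn
  · simp [W_self]
  rw [W_rec _ _ (by omega) (not_ear_of_odd (by simp)), if_pos rfl]
  refine congrArg (u * ·) ?_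
  rw [add_comm (2 * n) 1, sum_Icc_eq_sum_range, sum_range_two_mul_add_one, add_comm]
  refine congrArg₂ (· + ·) ?_ ?_
  · refine Finset.sum_congr rfl fun j hj => ?_
    rw [Finset.mem_range] at hj
    rw [W_eq_t _ (by omega), ← W_add_mul_two (2 * (n - 1 - j) + 1) u (zero_le) (j + 1)]
    congr 2 <;> omega
  · rw [Finset.sum_range_succ, Finset.sum_range_succ _ n, Nat.sub_self, mul_zero, zero_add, W_self,
      W_self, mul_zero, mul_zero, add_zero, add_zero]
    refine Finset.sum_congr rfl fun j hj => ?_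
    rw [Finset.mem_range] at hj
    rw [W_eq_t _ (by omega), ← W_add_mul_two (2 * (n - j) + 1) u (by omega) j]
    congr 2 <;> omega

theorem serOE_eq : serOE = 1 + serOO * serOE + serOE * serEE := by
  ext n
  rw [map_add, map_add, coeff_mul_eq_sum_range, coeff_mul_eq_sum_range, coeff_one]
  simp only [serOE, serOO, serEE, coeff_mk]
  rcases Nat.eq_zero_or_pos n with rfl | hn
  · simp [t_succ, t_self]
  rw [t_rec (by omega) (not_ear_of_odd (by simp)), if_neg hn.ne', zero_add,
    show 2 * n + 2 = 1 + (2 * n + 1) by ring, sum_Icc_eq_sum_range, Finset.sum_range_succ, t_self,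
    mul_zero, add_zero, sum_range_two_mul_add_one]
  refine congrArg₂ (· + ·) ?_ ?_
  · refine Finset.sum_congr rfl fun j hj => ?_
    rw [Finset.mem_range] at hj
    rw [← t_add_mul_two (a := 1) (b := 2 * (n - j) + 2) (by omega) j]
    congr 2 <;> omega
  · rw [Finset.sum_range_succ, Nat.sub_self, mul_zero, t_self, mul_zero, add_zero]
    refine Finset.sum_congr rfl fun j hj => ?_
    rw [Finset.mem_range] at hj
    rw [← t_add_mul_two (a := 0) (b := 2 * (n - j)) (by omega) (j + 1)]
    congr 2 <;> omega

/-- The correction `- X` is the triangle `0, 1, 2`, whose base is an ear. -/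
theorem serEE_eq : serEE = serEE * serEE + X * (serEO * serOE) - X := by
  ext n
  rw [map_sub, map_add, coeff_X_mul_eq_sum_range, coeff_mul_eq_sum_range, coeff_X]
  simp only [serOE, serEO, serEE, coeff_mk]
  by_cases h0 : n = 0
  · subst h0
    simp [t_self]
  by_cases h1 : n = 1
  · subst h1
    rw [show t 0 (2 * 1) = 0 from W_ear _ _ ⟨by decide, rfl⟩]
    simp [t_succ, Finset.sum_range_succ, t_self]
  rw [t_rec (by omega) (fun h => by have := h.2; omega), if_neg h1, sub_zero]
  have hz : 0 + 2 * n = 2 * n := zero_add _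
  conv_lhs => rw [← hz, sum_Icc_eq_sum_range, sum_range_two_mul_add_one]
  refine congrArg₂ (· + ·) ?_ ?_
  · refine Finset.sum_congr rfl fun j hj => ?_
    rw [Finset.mem_range] at hj
    rw [← t_add_mul_two (a := 0) (b := 2 * (n - j)) (by omega) j]
    congr 2 <;> omega
  · refine Finset.sum_congr rfl fun j hj => ?_
    rw [Finset.mem_range] at hj
    rw [← t_add_mul_two (a := 1) (b := 2 * (n - 1 - j) + 2) (by omega) j]
    congr 2 <;> omega

/-! ### Values of power series -/

/-- The power series `f` converges absolutely at `z`, with sum `a`. -/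
def HasValue (f : PowerSeries ℂ) (z a : ℂ) : Prop :=
  Summable (fun n => ‖coeff n f * z ^ n‖) ∧ ∑' n, coeff n f * z ^ n = a

namespace HasValue

variable {f g : PowerSeries ℂ} {z a b : ℂ}

theorem unique (hf : HasValue f z a) (hg : HasValue f z b) : a = b := hf.2.symm.trans hg.2

theorem add (hf : HasValue f z a) (hg : HasValue g z b) : HasValue (f + g) z (a + b) := by
  have h : ∀ n, coeff n (f + g) * z ^ n = coeff n f * z ^ n + coeff n g * z ^ n := fun n => by
    rw [map_add, add_mul]
  unfold HasValue
  simp only [h]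
  refine ⟨.of_nonneg_of_le (fun _ => norm_nonneg _) (fun _ => norm_add_le _ _) (hf.1.add hg.1), ?_⟩
  rw [hf.1.of_norm.tsum_add hg.1.of_norm, hf.2, hg.2]

theorem mul (hf : HasValue f z a) (hg : HasValue g z b) : HasValue (f * g) z (a * b) := by
  have h : ∀ n, coeff n (f * g) * z ^ n = ∑ p ∈ Finset.HasAntidiagonal.antidiagonal n,
      (coeff p.1 f * z ^ p.1) * (coeff p.2 g * z ^ p.2) := fun n => by
    rw [coeff_mul, Finset.sum_mul]
    refine Finset.sum_congr rfl fun p hp => ?_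
    rw [← Finset.HasAntidiagonal.mem_antidiagonal.1 hp]
    ring
  have hs := summable_norm_sum_mul_antidiagonal_of_summable_norm hf.1 hg.1
  have ht := tsum_mul_tsum_eq_tsum_sum_antidiagonal_of_summable_norm hf.1 hg.1
  simp only [← h] at hs ht
  exact ⟨hs, by rw [← ht, hf.2, hg.2]⟩

theorem monomial (n : ℕ) (c z : ℂ) : HasValue (PowerSeries.monomial n c) z (c * z ^ n) := by
  have h : ∀ m, m ≠ n → coeff m (PowerSeries.monomial n c) * z ^ m = 0 := fun m hm => by
    rw [coeff_monomial, if_neg hm, zero_mul]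
  refine ⟨summable_of_ne_finset_zero (s := {n}) fun m hm => ?_, ?_⟩
  · rw [h m (by simpa using hm), norm_zero]
  · rw [tsum_eq_single n h, coeff_monomial, if_pos rfl]

theorem const (c z : ℂ) : HasValue (C c) z c := by
  simpa [monomial_zero_eq_C] using monomial 0 c z

theorem one (z : ℂ) : HasValue 1 z 1 := by simpa using const 1 z

theorem X (z : ℂ) : HasValue X z z := by simpa [X_eq] using monomial 1 1 z

end HasValue

/-! ### Convergence for small arguments -/

theorem summable_of_coeff_le {f : PowerSeries ℂ} {K r : ℝ} {z : ℂ} (hr : 0 ≤ r)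
    (hf : ∀ n, ‖coeff n f‖ ≤ K * r ^ n) (hz : r * ‖z‖ < 1) :
    Summable (fun n => ‖coeff n f * z ^ n‖) := by
  have hs := (summable_geometric_of_lt_one (by positivity) hz).mul_left K
  refine hs.of_nonneg_of_le (fun _ => norm_nonneg _) fun n => ?_
  rw [norm_mul, norm_pow, mul_pow, ← mul_assoc]
  exact mul_le_mul_of_nonneg_right (hf n) (by positivity)

theorem exists_hasValue {f : PowerSeries ℂ} (hf : ∀ n, ‖coeff n f‖ ≤ 16 ^ n) {z : ℂ}
    (hz : ‖z‖ < 1 / 900) : ∃ a, HasValue f z a :=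
  ⟨_, summable_of_coeff_le (K := 1) (r := 16) (by norm_num) (by simpa using hf) (by linarith), rfl⟩

theorem HasValue.norm_sub_le {f : PowerSeries ℂ} (hf : ∀ n, ‖coeff n f‖ ≤ 16 ^ n) {z a : ℂ}
    (hz : ‖z‖ < 1 / 900) (h : HasValue f z a) : ‖a - coeff 0 f‖ ≤ 1 / 50 := by
  rw [← h.2, h.1.of_norm.tsum_eq_zero_add, pow_zero, mul_one, add_sub_cancel_left]
  have hs : HasSum (fun n : ℕ => (4 / 225 : ℝ) * (4 / 225) ^ n) (4 / 225 * (1 - 4 / 225)⁻¹) :=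
    (hasSum_geometric_of_lt_one (by norm_num) (by norm_num)).mul_left _
  refine (tsum_of_norm_bounded hs fun n => ?_).trans (by norm_num)
  rw [norm_mul, norm_pow, ← pow_succ']
  calc ‖coeff (n + 1) f‖ * ‖z‖ ^ (n + 1) ≤ 16 ^ (n + 1) * (1 / 900) ^ (n + 1) := by
        gcongr
        exact hf _
    _ = (4 / 225) ^ (n + 1) := by rw [← mul_pow]; norm_num

theorem norm_coeff_serEO_le (n : ℕ) : ‖coeff n serEO‖ ≤ 16 ^ n := by
  rw [serEO, coeff_mk]
  have := norm_t_le 0 (2 * n)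
  rw [zero_add, pow_mul] at this
  norm_num at this ⊢
  exact this

theorem norm_coeff_serOE_le (n : ℕ) : ‖coeff n serOE‖ ≤ 16 ^ n := by
  rw [serOE, coeff_mk]
  have := norm_t_le 1 (2 * n)
  rw [show 1 + 2 * n + 1 = 2 * n + 2 by ring, pow_mul] at this
  norm_num at this ⊢
  exact this

theorem four_pow_le (n : ℕ) : (4 : ℝ) ^ (2 * n + 1) ≤ 16 ^ (n + 1) := by
  rw [pow_succ, pow_succ, pow_mul]
  norm_num

theorem norm_coeff_serEE_le (n : ℕ) : ‖coeff n serEE‖ ≤ 16 ^ n := by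
  rw [serEE, coeff_mk]
  rcases n with _ | n
  · simp [t_self]
  have := norm_t_le 0 (2 * n + 1)
  rw [show 0 + (2 * n + 1) + 1 = 2 * (n + 1) by ring] at this
  exact this.trans (four_pow_le n)

theorem norm_coeff_serOO_le (n : ℕ) : ‖coeff n serOO‖ ≤ 16 ^ n := by
  rw [serOO, coeff_mk]
  rcases n with _ | n
  · simp [t_self]
  have := norm_t_le 1 (2 * n + 1)
  rw [show 1 + (2 * n + 1) + 1 = 2 * (n + 1) + 1 by ring] at this
  exact this.trans (four_pow_le n)

theorem norm_coeff_rootE_le (u : ℂ) (n : ℕ) :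
    ‖coeff n (rootE u)‖ ≤ max ‖u‖ 1 * (16 * max (‖u‖ ^ 2) 1) ^ n := by
  rw [rootE, coeff_mk]
  have := norm_W_le (2 * n + 1) u 0 (2 * n)
  rw [show 0 + 2 * n + 1 = 2 * n + 1 by ring] at this
  refine this.trans (le_of_eq ?_)
  have hm : max (‖u‖ ^ 2) 1 = max ‖u‖ 1 ^ 2 := by
    rw [(pow_left_monotoneOn (n := 2)).map_max (norm_nonneg u) zero_le_one, one_pow]
  rw [hm, mul_pow, pow_succ, pow_mul, pow_mul]
  norm_num
  ring

theorem norm_coeff_rootO_le (u : ℂ) (n : ℕ) :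
    ‖coeff n (rootO u)‖ ≤ max ‖u‖ 1 * (16 * max (‖u‖ ^ 2) 1) ^ n := by
  rw [rootO, coeff_mk]
  have hU : 1 ≤ max ‖u‖ 1 := le_max_right _ _
  rcases n with _ | n
  · rw [W_self, norm_zero]
    positivity
  have := norm_W_le (2 * (n + 1) + 1) u 1 (2 * n + 1)
  rw [show 1 + (2 * n + 1) + 1 = 2 * (n + 1) + 1 by ring] at this
  have hm : max (‖u‖ ^ 2) 1 = max ‖u‖ 1 ^ 2 := by
    rw [(pow_left_monotoneOn (n := 2)).map_max (norm_nonneg u) zero_le_one, one_pow]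
  rw [hm, mul_pow, ← pow_mul]
  have h1 := four_pow_le n
  calc _ ≤ _ := this
    _ = 4 ^ (2 * n + 1) * max ‖u‖ 1 ^ (2 * (n + 1)) := by ring
    _ ≤ 16 ^ (n + 1) * max ‖u‖ 1 ^ (2 * (n + 1)) := by gcongr
    _ ≤ max ‖u‖ 1 * (16 ^ (n + 1) * max ‖u‖ 1 ^ (2 * (n + 1))) :=
      le_mul_of_one_le_left (by positivity) hU

theorem summable_root {f : PowerSeries ℂ} {z u : ℂ}
    (hf : ∀ n, ‖coeff n f‖ ≤ max ‖u‖ 1 * (16 * max (‖u‖ ^ 2) 1) ^ n)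
    (hz : ‖z‖ * max (‖u‖ ^ 2) 1 < 1 / 900) : Summable (fun n => ‖coeff n f * z ^ n‖) :=
  summable_of_coeff_le (by positivity) hf (by linarith)

theorem Fterm_eq (z u : ℂ) (n : ℕ) : Fterm z u n = coeff (n + 1) (rootE u) * z ^ (n + 1) := by
  rw [Fterm, aeval_Q, rootE, coeff_mk]
  ring_nf

theorem summable_Fterm {z u : ℂ} (hz : ‖z‖ * max (‖u‖ ^ 2) 1 < 1 / 900) :
    Summable (Fterm z u) := by
  have := (summable_root (norm_coeff_rootE_le u) hz).of_norm
  simpa only [← Fterm_eq] using (summable_nat_add_iff 1).2 this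

/-- The term of index `0` of the series `rootE u`, a single side, is not part of `F`. -/
theorem hasValue_rootE {z u : ℂ} (hz : ‖z‖ * max (‖u‖ ^ 2) 1 < 1 / 900) :
    HasValue (rootE u) z (u + F z u) := by
  have hs := summable_root (norm_coeff_rootE_le u) hz
  refine ⟨hs, ?_⟩
  rw [hs.of_norm.tsum_eq_zero_add, F]
  simp only [Fterm_eq]
  simp [rootE, W_succ]

/-! ### Solving the equations of the generating functions -/

theorem eq_of_sq_eq_sq_of_re {a b : ℂ} (h : a ^ 2 = b ^ 2) (ha : 0 < a.re) (hb : 0 ≤ b.re) :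
    a = b := by
  rcases sq_eq_sq_iff_eq_or_eq_neg.1 h with h | h
  · exact h
  · rw [h, Complex.neg_re] at ha
    linarith

theorem sqrt_sq (x : ℂ) : (x ^ (1 / 2 : ℂ)) ^ 2 = x := by
  rw [one_div]
  exact Complex.cpow_nat_inv_pow x two_ne_zero

theorem sqrt_re_pos {x : ℂ} (hx : x ∈ Complex.slitPlane) : 0 < (x ^ (1 / 2 : ℂ)).re := by
  rw [Complex.cpow_def_of_ne_zero (Complex.slitPlane_ne_zero hx), Complex.exp_re]
  have h1 := Complex.neg_pi_lt_arg x
  have h2 := (Complex.arg_le_pi x).lt_of_ne (Complex.mem_slitPlane_iff_arg.1 hx).1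
  have h3 : (Complex.log x * (1 / 2)).im = x.arg / 2 := by
    simp [Complex.mul_im, Complex.log_im]
    ring
  rw [h3]
  exact mul_pos (Real.exp_pos _) (Real.cos_pos_of_mem_Ioo ⟨by linarith, by linarith⟩)

/-- The function `√(1 - 12 z)`. -/
noncomputable def w (z : ℂ) : ℂ := (1 - 12 * z) ^ (1 / 2 : ℂ)

/-- The function `√(2 + 4 z + 2 √(1 - 12 z))`, which is `2 / (1 + F(z, 1))`. -/
noncomputable def σ (z : ℂ) : ℂ := (2 + 4 * z + 2 * w z) ^ (1 / 2 : ℂ)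

theorem mem_slitPlane_of_norm_lt {z : ℂ} (hz : ‖z‖ < 1 / 900) : 1 - 12 * z ∈ Complex.slitPlane := by
  left
  have := (Complex.abs_re_le_norm z).trans_lt hz
  rw [abs_lt] at this
  simp
  linarith

theorem σ_arg_mem_slitPlane {z : ℂ} (hw : 0 < (w z).re) (hz : ‖z‖ < 1 / 4) :
    2 + 4 * z + 2 * w z ∈ Complex.slitPlane := by
  left
  have := (Complex.abs_re_le_norm z).trans_lt hz
  rw [abs_lt] at this
  simp
  linarith

/-- The values at `z` of the four generating functions satisfy the algebraic equations of the
polygons, and the branch of the solution is the one given by `σ`. Here `y = 1 / M` will be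
`1 / (1 + F(z, 1))`. -/
theorem exists_values {z : ℂ} (hz : ‖z‖ < 1 / 900) :
    ∃ E M O y : ℂ, HasValue serEE z E ∧ HasValue serEO z M ∧ HasValue serOE z M ∧
      HasValue serOO z O ∧ M * y = 1 ∧ E + O = 1 - y ∧ O - E = z * M ∧ z * M ^ 2 = O - O ^ 2 ∧
      1 - O ≠ 0 ∧ 2 * y = σ z ∧ w z = 2 * y ^ 2 - 1 - 2 * z := by
  obtain ⟨E, hE⟩ := exists_hasValue norm_coeff_serEE_le hz
  obtain ⟨M, hM⟩ := exists_hasValue norm_coeff_serEO_le hz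
  obtain ⟨P, hP⟩ := exists_hasValue norm_coeff_serOE_le hz
  obtain ⟨O, hO⟩ := exists_hasValue norm_coeff_serOO_le hz
  have bE := hE.norm_sub_le norm_coeff_serEE_le hz
  have bM := hM.norm_sub_le norm_coeff_serEO_le hz
  have bO := hO.norm_sub_le norm_coeff_serOO_le hz
  rw [serEE, coeff_mk, mul_zero, t_self, sub_zero] at bE
  rw [serEO, coeff_mk, mul_zero, t_succ] at bM
  rw [serOO, coeff_mk, mul_zero, t_self, sub_zero] at bO
  -- the functional equations
  have eM : M = 1 + E * M + M * O := by
    have h := rootE_eq 1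
    rw [rootE_one, rootO_one, map_one, one_mul] at h
    refine hM.unique ?_
    rw [h]
    exact ((HasValue.one z).add (hE.mul hM)).add (hM.mul hO)
  have eO : O = z * (P * M) + O * O := by
    have h := rootO_eq 1
    rw [rootE_one, rootO_one, map_one, one_mul] at h
    refine hO.unique ?_
    rw [h]
    exact ((HasValue.X z).mul (hP.mul hM)).add (hO.mul hO)
  have eP : P = 1 + O * P + P * E := by
    refine hP.unique ?_
    rw [serOE_eq]
    exact ((HasValue.one z).add (hO.mul hP)).add (hP.mul hE)
  have eE : E + z = E * E + z * (M * P) := by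
    refine (hE.add (HasValue.X z)).unique ?_
    rw [show serEE + X = serEE * serEE + X * (serEO * serOE) by
      nth_rw 1 [serEE_eq]; ring]
    exact (hE.mul hE).add ((HasValue.X z).mul (hM.mul hP))
  have hS : 1 - E - O ≠ 0 := by
    intro h0
    have h1 : M * (1 - E - O) = 1 := by linear_combination eM
    rw [h0, mul_zero] at h1
    exact zero_ne_one h1
  have hMP : P = M := by
    apply mul_right_cancel₀ hS
    linear_combination eP - eM
  rw [hMP] at hP eO eE
  obtain ⟨y, hy⟩ : ∃ y, y = 1 - E - O := ⟨_, rfl⟩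
  have hMy : M * y = 1 := by linear_combination eM + M * hy
  have hD : O - E = z * M := by
    linear_combination M * (eO - eE) - (O - E) * hMy + (O - E) * M * hy
  have hR : z * M ^ 2 = O - O ^ 2 := by linear_combination -eO
  have hz' : z = (O - O ^ 2) * y ^ 2 := by
    linear_combination y ^ 2 * hR - z * (M * y + 1) * hMy
  have hk : 2 * O - 1 + y = (O - O ^ 2) * y := by
    linear_combination hD + hy + y * hR - z * M * hMy
  -- the square root `w z` is singled out by the size of its real part
  have hy1 : ‖y - 1‖ ≤ 1 / 25 := by
    rw [hy, show 1 - E - O - 1 = -(E + O) by ring, norm_neg]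
    exact (norm_add_le _ _).trans (by linarith)
  have hy2 : ‖y ^ 2 - 1‖ ≤ 1 / 10 := by
    rw [show y ^ 2 - 1 = (y - 1) * (y - 1 + 2) by ring, norm_mul]
    have : ‖y - 1 + 2‖ ≤ 1 / 25 + 2 :=
      (norm_add_le _ _).trans (by rw [Complex.norm_two]; linarith)
    nlinarith [norm_nonneg (y - 1), norm_nonneg (y - 1 + 2)]
  have hyre := (Complex.abs_re_le_norm (y - 1)).trans hy1
  have hy2re := (Complex.abs_re_le_norm (y ^ 2 - 1)).trans hy2
  have hzre := (Complex.abs_re_le_norm z).trans hz.le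
  rw [abs_le, Complex.sub_re, Complex.one_re] at hyre hy2re
  rw [abs_le] at hzre
  have hwpos := sqrt_re_pos (mem_slitPlane_of_norm_lt hz)
  have hw : 2 * y ^ 2 - 1 - 2 * z = w z := by
    refine eq_of_sq_eq_sq_of_re ?_ ?_ hwpos.le
    · rw [w, sqrt_sq, hz']
      linear_combination 4 * y ^ 2 * (y - (O - O ^ 2) * y + 1 - 2 * O) * hk
    · have : (2 * y ^ 2 - 1 - 2 * z).re = 2 * (y ^ 2).re - 1 - 2 * z.re := by simp
      rw [this]
      linarith
  refine ⟨E, M, O, y, hE, hM, hP, hO, hMy, by linear_combination hy, hD, hR, ?_, ?_, hw.symm⟩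
  · intro h0
    have : O = 1 := by linear_combination -h0
    rw [this, norm_one] at bO
    norm_num at bO
  · refine eq_of_sq_eq_sq_of_re ?_ ?_
      (sqrt_re_pos (σ_arg_mem_slitPlane hwpos (by linarith))).le
    · rw [σ, sqrt_sq, ← hw]
      ring
    · have : (2 * y).re = 2 * y.re := by simp
      rw [this]
      linarith

theorem F_one {z : ℂ} (hz : ‖z‖ < 1 / 900) : F z 1 = 2 / σ z - 1 := by
  obtain ⟨E, M, O, y, -, hM, -, -, hMy, -, -, -, -, hσ, -⟩ := exists_values hz
  have h := hasValue_rootE (z := z) (u := 1) (by simpa using hz)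
  rw [rootE_one] at h
  have hF := h.unique hM
  have hy : y ≠ 0 := right_ne_zero_of_mul_eq_one hMy
  rw [← hσ]
  field_simp
  linear_combination y * hF + hMy

theorem hasDerivAt_F {z : ℂ} (hz : ‖z‖ < 1 / 900) :
    HasDerivAt (fun u => F z u) (8 / (σ z * (1 + σ z + w z)) - 1) 1 := by
  obtain ⟨E, M, O, y, hE, hM, hP, hO, hMy, hS, hD, hR, hO1, hσ, hw⟩ := exists_values hz
  have hy : y ≠ 0 := right_ne_zero_of_mul_eq_one hMy
  have hE' : E = 1 - y - O := by linear_combination hS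
  -- eliminating `rootO u` writes `F z u` as a rational function of `u`
  let den : ℂ → ℂ := fun u => (1 - u * E) * (1 - u * O) - u ^ 2 * (O - O ^ 2)
  have hden1 : den 1 = (1 - O) * y := by
    simp only [den, hE']
    ring
  have hden : HasDerivAt den (y - 1 - 2 * O * y) 1 := by
    have h1 : HasDerivAt (fun u : ℂ => 1 - u * E) (-(1 * E)) 1 :=
      ((hasDerivAt_id (1 : ℂ)).mul_const E).const_sub 1
    have h2 : HasDerivAt (fun u : ℂ => 1 - u * O) (-(1 * O)) 1 :=
      ((hasDerivAt_id (1 : ℂ)).mul_const O).const_sub 1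
    have h3 : HasDerivAt (fun u : ℂ => u ^ 2 * (O - O ^ 2)) (2 * (O - O ^ 2)) 1 := by
      simpa using (hasDerivAt_pow 2 (1 : ℂ)).mul_const (O - O ^ 2)
    refine ((h1.mul h2).sub h3).congr_deriv ?_
    rw [hE']
    ring
  have hden0 : den 1 ≠ 0 := by
    rw [hden1]
    exact mul_ne_zero hO1 hy
  have hnum : HasDerivAt (fun u : ℂ => u * (1 - u * O)) (1 - 2 * O) 1 := by
    have h2 : HasDerivAt (fun u : ℂ => 1 - u * O) (-(1 * O)) 1 :=
      ((hasDerivAt_id (1 : ℂ)).mul_const O).const_sub 1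
    refine ((hasDerivAt_id (1 : ℂ)).mul h2).congr_deriv ?_
    simp only [id]
    ring
  have hev : (fun u => F z u) =ᶠ[𝓝 1] fun u => u * (1 - u * O) / den u - u := by
    have hc : ContinuousAt (fun u : ℂ => ‖z‖ * max (‖u‖ ^ 2) 1) 1 := by fun_prop
    have h1 : ∀ᶠ u in 𝓝 (1 : ℂ), ‖z‖ * max (‖u‖ ^ 2) 1 < 1 / 900 :=
      hc.eventually_lt continuousAt_const (by simpa using hz)
    filter_upwards [h1, hden.continuousAt.eventually_ne hden0] with u hu hd
    have hEu := hasValue_rootE hu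
    obtain ⟨B, hB⟩ : ∃ B, HasValue (rootO u) z B :=
      ⟨_, summable_root (norm_coeff_rootO_le u) hu, rfl⟩
    have e1 : u + F z u = u * (1 + E * (u + F z u) + M * B) := by
      refine hEu.unique ?_
      rw [rootE_eq]
      exact (HasValue.const u z).mul (((HasValue.one z).add (hE.mul hEu)).add (hM.mul hB))
    have e2 : B = u * (z * (M * (u + F z u)) + O * B) := by
      refine hB.unique ?_
      rw [rootO_eq]
      exact (HasValue.const u z).mul (((HasValue.X z).mul (hP.mul hEu)).add (hO.mul hB))
    rw [eq_sub_iff_add_eq, eq_div_iff hd]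
    simp only [den]
    linear_combination (1 - u * O) * e1 + u * M * e2 + u ^ 2 * (u + F z u) * hR
  refine (((hnum.div hden hden0).sub (hasDerivAt_id 1)).congr_of_eventuallyEq hev).congr_deriv ?_
  rw [hden1, hw, ← hσ]
  have hzy : z = (2 * O - 1 + y) * y := by
    linear_combination -z * hMy - y * hD - y * hE'
  have h1 : 1 + 2 * y + (2 * y ^ 2 - 1 - 2 * z) = 4 * (1 - O) * y := by
    rw [hzy]
    ring
  rw [h1]
  field_simp
  ring

/-! ### Analytic continuation and the expansion at `1 / 12` -/

theorem mem_slitPlane_of_mem_slitDisk {R : ℝ} {z : ℂ} (hz : z ∈ slitDisk R) :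
    1 - 12 * z ∈ Complex.slitPlane := by
  by_contra h
  rw [Complex.mem_slitPlane_iff_not_le_zero, not_not, Complex.le_def] at h
  refine hz.2 ⟨z.re, ?_, ?_⟩
  · have := h.1
    simp at this
    rw [Set.mem_Ici]
    linarith
  · have := h.2
    simp at this
    exact Complex.ext rfl this.symm

theorem σ_mem_slitPlane_of_mem_slitDisk {z : ℂ} (hz : z ∈ slitDisk (1 / 4)) :
    2 + 4 * z + 2 * w z ∈ Complex.slitPlane :=
  σ_arg_mem_slitPlane (sqrt_re_pos (mem_slitPlane_of_mem_slitDisk hz)) hz.1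

theorem analyticAt_w {z : ℂ} (hz : z ∈ slitDisk (1 / 4)) : AnalyticAt ℂ w z :=
  AnalyticAt.cpow (by fun_prop) analyticAt_const (mem_slitPlane_of_mem_slitDisk hz)

theorem analyticAt_σ {z : ℂ} (hz : z ∈ slitDisk (1 / 4)) : AnalyticAt ℂ σ z := by
  have := analyticAt_w hz
  exact AnalyticAt.cpow (by fun_prop) analyticAt_const (σ_mem_slitPlane_of_mem_slitDisk hz)

theorem re_pos_ne_zero {z : ℂ} (h : 0 < z.re) : z ≠ 0 := fun h0 => by simp [h0] at h

/-- The first-order Taylor expansion of an analytic function, with its error term. -/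
theorem taylor_one_isBigO {f : ℂ → ℂ} {f' : ℂ} (hf : AnalyticAt ℂ f 0) (hd : HasDerivAt f f' 0) :
    (fun x => f x - (f 0 + f' * x)) =O[𝓝 0] fun x => x ^ 2 := by
  obtain ⟨p, hp⟩ := hf
  have h := hp.isBigO_sub_partialSum_pow 2
  have h0 : ∀ v, p 0 v = f 0 := fun v => hp.coeff_zero v
  have h1 : p.coeff 1 = f' := hp.hasDerivAt.unique hd |>.symm ▸ rfl
  refine (h.congr_left fun x => ?_).trans (by simp [← norm_pow, isBigO_refl])
  have h2 : p.coeff 0 = f 0 := h0 _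
  simp [FormalMultilinearSeries.partialSum, Finset.sum_range_succ, h1, h2, mul_comm]

theorem w_sq (z : ℂ) : w z ^ 2 = 1 - 12 * z := sqrt_sq _

theorem tendsto_w : Tendsto w (𝓝 (1 / 12)) (𝓝 0) := by
  have h : ∀ z, ‖w z‖ = √‖1 - 12 * z‖ := fun z => by
    rw [← w_sq, norm_pow, Real.sqrt_sq (norm_nonneg _)]
  rw [tendsto_zero_iff_norm_tendsto_zero]
  simp only [h]
  have hc : ContinuousAt (fun z : ℂ => √‖1 - 12 * z‖) (1 / 12) := by fun_prop
  simpa [ContinuousAt] using hc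

/-- The function `σ` in terms of `w`, using `z = (1 - w ^ 2) / 12`. -/
noncomputable def s (x : ℂ) : ℂ := (7 / 3 + 2 * x - x ^ 2 / 3) ^ (1 / 2 : ℂ)

theorem σ_eq (z : ℂ) : σ z = s (w z) := by
  rw [σ, s, w_sq]
  congr 1
  ring

theorem s_zero : s 0 = ((√21 : ℝ) : ℂ) / 3 := by
  have h : s 0 ^ 2 = 7 / 3 := by
    rw [s, sqrt_sq]
    norm_num
  have hr : ((√21 : ℝ) : ℂ) ^ 2 = 21 := by
    rw [← Complex.ofReal_pow, Real.sq_sqrt (by norm_num)]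
    norm_num
  have h2 : (((√21 : ℝ) : ℂ) / 3).re = √21 / 3 := by
    rw [← Complex.ofReal_ofNat, ← Complex.ofReal_div, Complex.ofReal_re]
  refine (eq_of_sq_eq_sq_of_re ?_ ?_ ?_).symm
  · rw [h, div_pow, hr]
    norm_num
  · rw [h2]
    positivity
  · refine (sqrt_re_pos ?_).le
    left
    norm_num

theorem analyticAt_s : AnalyticAt ℂ s 0 := by
  refine AnalyticAt.cpow (by fun_prop) analyticAt_const ?_
  left
  norm_num

theorem hasDerivAt_s : HasDerivAt s (s 0)⁻¹ 0 := by
  have hd := analyticAt_s.differentiableAt.hasDerivAt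
  have h0 : s 0 ≠ 0 := by
    rw [s_zero]
    simp
  -- differentiate `s x ^ 2`
  have h1 : HasDerivAt (fun x => s x ^ 2) 2 0 := by
    have h : (fun x => s x ^ 2) = fun x => 7 / 3 + 2 * x - x ^ 2 / 3 := funext fun x => sqrt_sq _
    rw [h]
    have h2 : HasDerivAt (fun x : ℂ => x ^ 2 / 3) 0 0 := by
      simpa using (hasDerivAt_pow 2 (0 : ℂ)).div_const 3
    have h3 : HasDerivAt (fun x : ℂ => 7 / 3 + 2 * x) 2 0 := by
      simpa using ((hasDerivAt_id (0 : ℂ)).const_mul 2).const_add (7 / 3)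
    exact (h3.sub h2).congr_deriv (sub_zero _)
  have h2 := (hd.pow 2).unique h1
  have h3 : deriv s 0 = (s 0)⁻¹ := by
    simp at h2
    field_simp
    linear_combination h2 / 2
  rwa [h3] at hd

theorem isBigO_comp_w {f : ℂ → ℂ} {f' : ℂ} (hf : AnalyticAt ℂ f 0) (hd : HasDerivAt f f' 0)
    {R : ℝ} : (fun z => f (w z) - (f 0 + f' * w z)) =O[𝓝[slitDisk R] (1 / 12 : ℂ)]
      fun z => 1 - 12 * z := by
  have := (taylor_one_isBigO hf hd).comp_tendsto
    (tendsto_w.mono_left (nhdsWithin_le_nhds (s := slitDisk R)))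
  refine this.congr (fun _ => rfl) fun z => w_sq z

end DoubleCircle

theorem proposition4p7 :
    (∀ z u : ℂ, ‖z‖ * max (‖u‖ ^ 2) 1 < 1 / 900 → Summable (DoubleCircle.Fterm z u)) ∧
    ∃ R : ℝ, 1 / 12 < R ∧ ∃ G H : ℂ → ℂ,
      AnalyticOnNhd ℂ G (DoubleCircle.slitDisk R) ∧
      AnalyticOnNhd ℂ H (DoubleCircle.slitDisk R) ∧
      (∀ z : ℂ, ‖z‖ < 1 / 900 →
        G z = DoubleCircle.F z 1 ∧ HasDerivAt (fun u => DoubleCircle.F z u) (H z) 1) ∧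
      (fun z : ℂ => G z -
          ((DoubleCircle.c₁ : ℂ) - (DoubleCircle.c₂ : ℂ) * (1 - 12 * z) ^ (1 / 2 : ℂ)))
        =O[𝓝[DoubleCircle.slitDisk R] (1 / 12 : ℂ)] (fun z : ℂ => 1 - 12 * z) ∧
      (fun z : ℂ => H z -
          ((DoubleCircle.d₁ : ℂ) - (DoubleCircle.d₂ : ℂ) * (1 - 12 * z) ^ (1 / 2 : ℂ)))
        =O[𝓝[DoubleCircle.slitDisk R] (1 / 12 : ℂ)] (fun z : ℂ => 1 - 12 * z) := by
  open DoubleCircle in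
  have hσ : ∀ z ∈ slitDisk (1 / 4), 0 < (σ z).re :=
    fun z hz => sqrt_re_pos (σ_mem_slitPlane_of_mem_slitDisk hz)
  have hσ' : ∀ z ∈ slitDisk (1 / 4), 1 + σ z + w z ≠ 0 := by
    intro z hz
    have h1 := hσ z hz
    have h2 := sqrt_re_pos (mem_slitPlane_of_mem_slitDisk hz)
    refine re_pos_ne_zero ?_
    change 0 < (w z).re at h2
    rw [Complex.add_re, Complex.add_re, Complex.one_re]
    linarith
  have hr : ((√21 : ℝ) : ℂ) ^ 2 = 21 := by
    rw [← Complex.ofReal_pow, Real.sq_sqrt (by norm_num)]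
    norm_num
  have hr0 : ((√21 : ℝ) : ℂ) ≠ 0 := by simp
  have hr7 : (7 - (√21 : ℝ) : ℂ) ≠ 0 := by
    intro h
    have h1 : ((√21 : ℝ) : ℂ) = 7 := by linear_combination -h
    rw [h1] at hr
    norm_num at hr
  have hr3 : (3 + (√21 : ℝ) : ℂ) ≠ 0 := by
    intro h
    have h1 : ((√21 : ℝ) : ℂ) = -3 := by linear_combination h
    rw [h1] at hr
    norm_num at hr
  have hs0 : s 0 ≠ 0 := by
    rw [s_zero]
    simp
  have hs1 : s 0 * (1 + s 0 + 0) ≠ 0 := by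
    refine mul_ne_zero hs0 fun h => hr3 ?_
    rw [s_zero] at h
    linear_combination 3 * h
  refine ⟨fun z u => summable_Fterm, 1 / 4, by norm_num, fun z => 2 / σ z - 1,
    fun z => 8 / (σ z * (1 + σ z + w z)) - 1, ?_, ?_,
    fun z hz => ⟨(F_one hz).symm, hasDerivAt_F hz⟩, ?_, ?_⟩
  · intro z hz
    exact (analyticAt_const.div (analyticAt_σ hz) (re_pos_ne_zero (hσ z hz))).sub analyticAt_const
  · intro z hz
    have a1 := analyticAt_σ hz
    have a2 := analyticAt_w hz
    exact (analyticAt_const.div (a1.mul ((analyticAt_const.add a1).add a2))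
      (mul_ne_zero (re_pos_ne_zero (hσ z hz)) (hσ' z hz))).sub analyticAt_const
  · have ha : AnalyticAt ℂ (fun x => 2 / s x - 1) 0 :=
      (analyticAt_const.div analyticAt_s hs0).sub analyticAt_const
    have hd : HasDerivAt (fun x => 2 / s x - 1) (-c₂ : ℂ) 0 := by
      refine (((hasDerivAt_const (0 : ℂ) (2 : ℂ)).div hasDerivAt_s hs0).sub_const 1).congr_deriv ?_
      rw [s_zero, c₂]
      push_cast
      generalize ((√21 : ℝ) : ℂ) = r at *
      field_simp
      linear_combination (882 - 252 * r + 60 * r ^ 2 - 12 * r ^ 3) * hr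
    have hc : 2 / s 0 - 1 = (c₁ : ℂ) := by
      rw [s_zero, c₁]
      push_cast
      generalize ((√21 : ℝ) : ℂ) = r at *
      field_simp
      linear_combination -2 * hr
    refine (isBigO_comp_w ha hd).congr_left fun z => ?_
    simp only [σ_eq, hc]
    rw [w]
    ring
  · have hd2 : HasDerivAt (fun x => s x * (1 + s x + x))
        ((s 0)⁻¹ * (1 + s 0 + 0) + s 0 * ((s 0)⁻¹ + 1)) 0 :=
      hasDerivAt_s.mul ((hasDerivAt_s.const_add 1).add (hasDerivAt_id 0))
    have ha : AnalyticAt ℂ (fun x => 8 / (s x * (1 + s x + x)) - 1) 0 :=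
      (analyticAt_const.div (analyticAt_s.mul ((analyticAt_const.add analyticAt_s).add
        analyticAt_id)) hs1).sub analyticAt_const
    have hd : HasDerivAt (fun x => 8 / (s x * (1 + s x + x)) - 1) (-d₂ : ℂ) 0 := by
      refine (((hasDerivAt_const (0 : ℂ) (8 : ℂ)).div hd2 hs1).sub_const 1).congr_deriv ?_
      rw [s_zero, d₂, c₂]
      push_cast
      simp only [add_zero]
      generalize ((√21 : ℝ) : ℂ) = r at *
      field_simp
      linear_combination (10584 + 504 * r - 288 * r ^ 2 + 96 * r ^ 3 - 48 * r ^ 4) * hr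
    have hc : 8 / (s 0 * (1 + s 0 + 0)) - 1 = (d₁ : ℂ) := by
      rw [s_zero, d₁]
      push_cast
      simp only [add_zero]
      generalize ((√21 : ℝ) : ℂ) = r at *
      field_simp
      linear_combination (-24 + 12 * r) * hr
    refine (isBigO_comp_w ha hd).congr_left fun z => ?_
    simp only [σ_eq, hc]
    rw [w]
    ring
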